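/- Let $(m_{\sigma,\tau})_{\sigma,\tau\in S}$ be a Coxeter matrix whose Coxeter group is finite. Let $A^+$ be the monoid and $A$ the group (the Artin--Tits monoid and group of spherical type) presented by the generators $S$ and the relations $\mathrm{prod}(\sigma,\tau,m_{\sigma,\tau})=\mathrm{prod}(\tau,\sigma,m_{\sigma,\tau})$ for $\sigma\neq\tau$ in $S$, where $\mathrm{prod}(\sigma,\tau,m)$ is the alternated product $\sigma\tau\sigma\tau\cdots$ with $m$ factors. Elements of $A^+$ are also regarded as elements of $A$ through the canonical homomorphism $A^+\to A$. A *Garside element* of $A^+$ is an element whose left and right divisors coincide, generate $A^+$, and are finite in number. The *norm* of an element is the supremum of the lengths of its expressions as a product of atoms. Let $\Delta$ be the Garside element of minimal norm; its divisors are called *simple*. A simple element $s$ is *pure* if, for every $k\ge 1$, $s$ is the maximal simple right divisor of $s^k$ (it is a right divisor of $s^k$ and every simple right divisor of $s^k$ is a right divisor of $s$). For $s$ pure and $x\in A$, write $x=z\Delta^k$ with $z\in A^+$, $k\in\mathbb Z$; the *(left) valuation* $\nu_s(x)$ is $n+k$, where $n$ is the largest integer such that $s^n$ is a left divisor of $z$.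 Two tuples of integers $(k_i)_{i\in S}$ and $(k'_i)_{i\in S}$ are *order-equivalent* if, for all $i,j$, one has $k_i=k_j\iff k'_i=k'_j$ and $k_i<k_j\iff k'_i<k'_j$; the classes are called *order-types*. The *type* of $x\in A$ is the order-type of $(\nu_\sigma(x))_{\sigma\in S}$. Two order-types $T,T'$ are *neighbours* if there exist $(k_i)\in T$ and $(k'_i)\in T'$ such that either $k'_i-k_i\in\{0,1\}$ for every $i$, or $k'_i-k_i\in\{0,-1\}$ for every $i$. Then these notions are well defined (there is exactly one Garside element of minimal norm, every $\sigma\in S$ is a pure simple element, and for all $\sigma\in S$, $x\in A$ there is a decomposition $x=z\Delta^k$ as above and $\nu_\sigma(x)$ does not depend on its choice), and, for every $x\in A$ and every simple element $s$ of $A^+$, the type of $xs$ and the type of $xs^{-1}$ are both neighbours of the type of $x$. -/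

import Mathlib

/-! ### Garside elements, simple elements, valuations -/

section Garside

variable {P : Type*} [Monoid P]

/-- `s` is a right divisor of `x`. (Left divisibility is Mathlib's `s ∣ x`, i.e. `∃ c, x = s * c`.) -/
def IsRightDivisor (s x : P) : Prop := ∃ c, x = c * s

/-- A Garside element: its left and right divisors coincide, they generate the monoid, and they
are finite in number. -/
def IsGarsideElement (d : P) : Prop :=
  (∀ s : P, s ∣ d ↔ IsRightDivisor s d) ∧
    Submonoid.closure {s : P | s ∣ d} = ⊤ ∧ {s : P | s ∣ d}.Finite

/-- The norm of `x`: the supremum of the lengths of the expressions of `x` as a product of atoms. -/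
noncomputable def atomNorm (x : P) : ℕ∞ :=
  ⨆ l ∈ {l : List P | (∀ a ∈ l, Irreducible a) ∧ l.prod = x}, (l.length : ℕ∞)

/-- `d` is a Garside element of minimal norm. -/
def IsMinimalGarsideElement (d : P) : Prop :=
  IsGarsideElement d ∧ ∀ d' : P, IsGarsideElement d' → atomNorm d ≤ atomNorm d'

variable (P) in
/-- The element `Δ`: the (unique) Garside element of minimal norm. -/
noncomputable def garsideDelta : P := Classical.epsilon (IsMinimalGarsideElement (P := P))

/-- The simple elements are the divisors of `Δ`. -/
def IsSimpleElement (s : P) : Prop := s ∣ garsideDelta P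

/-- A simple element `s` is pure if, for every `k ≥ 1`, it is the maximal simple right divisor
of `s ^ k`. -/
def IsPureSimple (s : P) : Prop :=
  IsSimpleElement s ∧ ∀ k : ℕ, 1 ≤ k →
    IsRightDivisor s (s ^ k) ∧
      ∀ t : P, IsSimpleElement t → IsRightDivisor t (s ^ k) → IsRightDivisor t s

variable {G : Type*} [Group G]

/-- `v` is the left valuation of `s` in the element `x` of the group `G`, where `ι` is the canonical
map from the monoid to `G`: one has `x = z Δ ^ k` with `z` in the monoid, and `v = n + k`
where `n` is maximal such that `s ^ n` left divides `z`. -/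
def IsValuation (ι : P →* G) (s : P) (x : G) (v : ℤ) : Prop :=
  ∃ (z : P) (k : ℤ) (n : ℕ), x = ι z * ι (garsideDelta P) ^ k ∧
    IsGreatest {m : ℕ | s ^ m ∣ z} n ∧ v = n + k

/-- The left valuation `ν_s(x)` of `s` in `x`. -/
noncomputable def valuationOf (ι : P →* G) (s : P) (x : G) : ℤ :=
  Classical.epsilon (IsValuation ι s x)

end Garside

/-! ### Artin–Tits monoids and groups -/

/-- The alternated product `a b a b …` with `m` factors. -/
def altProd {N : Type*} [Monoid N] : ℕ → N → N → N
  | 0, _, _ => 1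
  | m + 1, a, b => a * altProd m b a

theorem map_altProd {N N' : Type*} [Monoid N] [Monoid N'] (f : N →* N') (m : ℕ) (a b : N) :
    f (altProd m a b) = altProd m (f a) (f b) := by
  induction m generalizing a b with
  | zero => simp [altProd]
  | succ m ih => simp [altProd, ih]

namespace CoxeterMatrix

variable {S : Type*} (M : CoxeterMatrix S)

/-- The Artin–Tits relations `prod(σ, τ, m_{σ,τ}) = prod(τ, σ, m_{σ,τ})` for `σ ≠ τ`, on the free
monoid. -/
def ArtinRel (u v : FreeMonoid S) : Prop :=
  ∃ i j : S, i ≠ j ∧ u = altProd (M i j) (FreeMonoid.of i) (FreeMonoid.of j) ∧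
    v = altProd (M i j) (FreeMonoid.of j) (FreeMonoid.of i)

/-- The Artin–Tits monoid `A⁺`. -/
abbrev ArtinMonoid : Type _ := PresentedMonoid M.ArtinRel

/-- The same relations, as elements of the free group. -/
def artinRelators : Set (FreeGroup S) :=
  {r | ∃ i j : S, i ≠ j ∧ r = altProd (M i j) (FreeGroup.of i) (FreeGroup.of j) *
    (altProd (M i j) (FreeGroup.of j) (FreeGroup.of i))⁻¹}

/-- The Artin–Tits group `A`. -/
abbrev ArtinGroup : Type _ := PresentedGroup M.artinRelators

/-- The generator `σ` of the Artin–Tits monoid. -/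
def artinGen (i : S) : M.ArtinMonoid := PresentedMonoid.of M.ArtinRel i

theorem lift_eq_of_artinRel (u v : FreeMonoid S) (h : M.ArtinRel u v) :
    FreeMonoid.lift (fun i => (PresentedGroup.of i : M.ArtinGroup)) u =
      FreeMonoid.lift (fun i => (PresentedGroup.of i : M.ArtinGroup)) v := by
  obtain ⟨i, j, hij, rfl, rfl⟩ := h
  have key := PresentedGroup.mk_eq_mk_of_mul_inv_mem
    (rels := M.artinRelators) ⟨i, j, hij, rfl⟩
  rw [map_altProd, map_altProd] at key
  rw [map_altProd, map_altProd]
  simp only [FreeMonoid.lift_eval_of]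
  exact key

/-- The canonical homomorphism `A⁺ → A`. -/
def artinMonoidToGroup : M.ArtinMonoid →* M.ArtinGroup :=
  PresentedMonoid.lift (fun i => (PresentedGroup.of i : M.ArtinGroup)) M.lift_eq_of_artinRel

/-- The valuation sequence `(ν_σ(x) ; σ ∈ S)`. -/
noncomputable def valuationSequence (x : M.ArtinGroup) : S → ℤ :=
  fun i => valuationOf M.artinMonoidToGroup (M.artinGen i) x

end CoxeterMatrix

/-! ### Order-types of tuples of integers -/

/-- Order-equivalence of tuples of integers. -/
def orderEquiv (I : Type*) : Setoid (I → ℤ) where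
  r k k' := ∀ i j : I, (k i = k j ↔ k' i = k' j) ∧ (k i < k j ↔ k' i < k' j)
  iseqv :=
    { refl := fun _ _ _ => ⟨Iff.rfl, Iff.rfl⟩
      symm := fun h i j => ⟨(h i j).1.symm, (h i j).2.symm⟩
      trans := fun h h' i j => ⟨(h i j).1.trans (h' i j).1, (h i j).2.trans (h' i j).2⟩ }

/-- Order-types: the order-equivalence classes of tuples. -/
abbrev TupleOrderType (I : Type*) : Type _ := Quotient (orderEquiv I)

/-- The order-type of a tuple. -/
def orderTypeOf {I : Type*} (k : I → ℤ) : TupleOrderType I := Quotient.mk (orderEquiv I) k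

/-- Two order-types are neighbours if they contain tuples whose coordinatewise differences are all
in `{0, 1}` or all in `{0, -1}`. -/
def AreNeighbours {I : Type*} (T T' : TupleOrderType I) : Prop :=
  ∃ k k' : I → ℤ, orderTypeOf k = T ∧ orderTypeOf k' = T' ∧
    ((∀ i, k' i - k i = 0 ∨ k' i - k i = 1) ∨ (∀ i, k' i - k i = 0 ∨ k' i - k i = -1))

/-- The type of an element of an Artin–Tits group: the order-type of its valuation sequence. -/
noncomputable def CoxeterMatrix.typeOf {S : Type*} (M : CoxeterMatrix S) (x : M.ArtinGroup) :
    TupleOrderType S :=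
  orderTypeOf (M.valuationSequence x)

/-! Right multiplication by `Δ` raises every valuation by exactly one, and right multiplication by a
positive element lowers none. A simple `s` has a cofactor `u` with `s u = Δ`, so `ν(x) ≤ ν(xs) ≤
ν(xsu) = ν(x) + 1` for each generator. The valuation tuples themselves therefore witness that the
types are neighbours, and the case of `s⁻¹` is the same statement at `x s⁻¹`.

The substance lies in the well-definedness. Since `A⁺` embeds in `A`, two decompositions `x = z Δ ^
k` differ by moving powers of `Δ`, and `artinGen_pow_succ_dvd_mul_delta_iff` shows that replacing
`z` by `z Δ` raises the exponent of `σ` by exactly one. That lemma rests on purity: the greatest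
simple left divisor (head) of a product depends on the right factor only through the head of that
factor (`head_mul_congr`), and `σ ^ (n + 1)` has the same head as `σ`.

The Garside structure is read off the finite Coxeter group `W`. Strong exchange and the exact orders
of products of two generators give the dihedral factor of an element with two descents
(`exists_eq_altSimple_mul`), from which follow Matsumoto's theorem, hence a section `toArtin : W →
A⁺`, and meets in the weak order. The longest element turns additivity of lengths into a prefix
condition (`lengthAdd_iff_isPrefix`), so heads of products are computed by meets. This yields an
action of `A⁺` on pairs (head, tail), `germHom`; the orbit of `(1, 1)` provides greatest simple
divisors and left cancellation, and reversal provides right cancellation. Every element divides a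
power of `Δ`, so the Ore localization embeds `A⁺` in a group, and therefore in `A`. -/

/-! ### The strong exchange condition -/

namespace CoxeterSystem

variable {S : Type*} {W : Type*} [Group W] {M : CoxeterMatrix S} (cs : CoxeterSystem M W)

open Classical in
/-- The involution `(t, ε) ↦ (s t s, ε + [t = s])` attached to the simple reflection `s`. -/
noncomputable def signedConj (i : S) : Equiv.Perm (W × ZMod 2) :=
  Function.Involutive.toPerm
    (fun p => (cs.simple i * p.1 * cs.simple i, p.2 + if p.1 = cs.simple i then 1 else 0))
    (by
      rintro ⟨t, e⟩
      have h : cs.simple i * t * cs.simple i = cs.simple i ↔ t = cs.simple i := by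
        constructor
        · intro h
          have := congrArg (fun x => cs.simple i * x * cs.simple i) h
          simpa [mul_assoc] using this
        · rintro rfl; simp
      simp only [h, Prod.mk.injEq]
      refine ⟨by simp [mul_assoc], ?_⟩
      split_ifs <;> simp [add_assoc, CharTwo.add_self_eq_zero])

open Classical in
theorem signedConj_apply (i : S) (t : W) (e : ZMod 2) :
    cs.signedConj i (t, e) =
      (cs.simple i * t * cs.simple i, e + if t = cs.simple i then 1 else 0) := rfl

-- Each of the `2k` simple factors flips the sign when the current conjugate of `t` equals that
-- factor. With `d` the product of the two simple reflections, solving for `t` gives the values `d⁻ˡ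
-- sⱼ`.
open Classical in
theorem signedConj_mul_pow_apply (i j : S) (k : ℕ) (t : W) (e : ZMod 2) :
    ((cs.signedConj i * cs.signedConj j) ^ k) (t, e) =
      ((cs.simple i * cs.simple j) ^ k * t * ((cs.simple i * cs.simple j) ^ k)⁻¹,
        e + ∑ l ∈ Finset.range (2 * k),
          if t = ((cs.simple i * cs.simple j) ^ l)⁻¹ * cs.simple j then 1 else 0) := by
  induction k generalizing t e with
  | zero => simp
  | succ k ih =>
    set d := cs.simple i * cs.simple j with hd
    have hsd : ∀ n : ℕ, cs.simple j * d ^ n = (d ^ n)⁻¹ * cs.simple j := by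
      intro n
      have h : cs.simple j * d = d⁻¹ * cs.simple j := by simp [hd, mul_assoc]
      induction n with
      | zero => simp
      | succ n ihn =>
        rw [pow_succ, ← mul_assoc, ihn, mul_assoc, h, ← mul_assoc, ← mul_inv_rev, ← pow_succ, ← pow_succ']
    rw [pow_succ', Equiv.Perm.mul_apply, ih, Equiv.Perm.mul_apply, signedConj_apply,
      signedConj_apply, show 2 * (k + 1) = 2 * k + 1 + 1 by ring, Finset.sum_range_succ,
      Finset.sum_range_succ]
    have h1 : d ^ k * t * (d ^ k)⁻¹ = cs.simple j ↔ t = (d ^ (2 * k))⁻¹ * cs.simple j := by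
      rw [mul_inv_eq_iff_eq_mul, hsd, ← eq_inv_mul_iff_mul_eq, two_mul, pow_add, mul_inv_rev,
        mul_assoc]
    have h2 : cs.simple j * (d ^ k * t * (d ^ k)⁻¹) * cs.simple j = cs.simple i ↔
        t = (d ^ (2 * k + 1))⁻¹ * cs.simple j := by
      have e1 : cs.simple i = d * cs.simple j := by simp [hd, mul_assoc]
      have e2 : cs.simple j * (cs.simple i * cs.simple j) * (d ^ k) = (d ^ (k + 1))⁻¹ * cs.simple j := by
        rw [← hd, mul_assoc, ← pow_succ', hsd]
      constructor
      · intro h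
        have h' : t = (d ^ k)⁻¹ * (cs.simple j * cs.simple i * cs.simple j * d ^ k) := by
          rw [← h]; simp [mul_assoc]
        rw [h', mul_assoc (cs.simple j), e2, show 2 * k + 1 = k + 1 + k by ring, pow_add _ (k + 1),
          mul_inv_rev, mul_assoc]
      · intro h
        have h' : t = (d ^ k)⁻¹ * (cs.simple j * (cs.simple i * cs.simple j) * d ^ k) := by
          rw [e2, h, show 2 * k + 1 = k + 1 + k by ring, pow_add _ (k + 1), mul_inv_rev, mul_assoc]
        rw [h']; simp [mul_assoc]
    simp only [h1, h2]
    refine Prod.ext ?_ ?_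
    · simp only [pow_succ', mul_inv_rev, hd, cs.inv_simple, mul_assoc]
    · simp only [add_assoc]

/-- For `k = M i j` the terms of index `l` and `M i j + l` agree, so the sign changes cancel modulo
2. -/
theorem signedConj_isLiftable : M.IsLiftable cs.signedConj := by
  classical
  intro i j
  ext ⟨t, e⟩ : 1
  rw [signedConj_mul_pow_apply, cs.simple_mul_simple_pow, two_mul, Finset.sum_range_add]
  simp only [pow_add, cs.simple_mul_simple_pow, one_mul, mul_one, inv_one, CharTwo.add_self_eq_zero,
    add_zero, Equiv.Perm.coe_one, id_eq]

/-- The action of a Coxeter group on its signed reflections. -/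
noncomputable def signedConjHom : W →* Equiv.Perm (W × ZMod 2) :=
  cs.lift ⟨cs.signedConj, cs.signedConj_isLiftable⟩

open Classical in
theorem signedConjHom_wordProd (ω : List S) (t : W) (e : ZMod 2) :
    cs.signedConjHom (cs.wordProd ω) (t, e) =
      (cs.wordProd ω * t * (cs.wordProd ω)⁻¹, e + (cs.rightInvSeq ω).count t) := by
  induction ω with
  | nil => simp
  | cons i ω ih =>
    rw [cs.wordProd_cons, map_mul, Equiv.Perm.mul_apply, ih, signedConjHom, cs.lift_apply_simple,
      signedConj_apply, rightInvSeq, List.count_cons]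
    refine Prod.ext ?_ ?_
    · simp [mul_assoc]
    · have : (cs.wordProd ω * t * (cs.wordProd ω)⁻¹ = cs.simple i) ↔
          ((cs.wordProd ω)⁻¹ * cs.simple i * cs.wordProd ω = t) := by
        rw [mul_inv_eq_iff_eq_mul, ← eq_inv_mul_iff_mul_eq, mul_assoc, eq_comm]
      simp only [this, beq_iff_eq, Nat.cast_add, Nat.cast_ite, Nat.cast_one, Nat.cast_zero, add_assoc]

/-- The parity of the number of occurrences of `t` in the right inversion sequence of a word
for `w`. -/
noncomputable def invParity (w t : W) : ZMod 2 := (cs.signedConjHom w (t, 0)).2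

open Classical in
theorem invParity_wordProd (ω : List S) (t : W) :
    cs.invParity (cs.wordProd ω) t = (cs.rightInvSeq ω).count t := by
  simp [invParity, signedConjHom_wordProd]

theorem signedConjHom_apply (w t : W) (e : ZMod 2) :
    cs.signedConjHom w (t, e) = (w * t * w⁻¹, e + cs.invParity w t) := by
  obtain ⟨ω, rfl⟩ := cs.wordProd_surjective w
  rw [invParity_wordProd, signedConjHom_wordProd]

theorem invParity_mul (w v t : W) :
    cs.invParity (w * v) t = cs.invParity v t + cs.invParity w (v * t * v⁻¹) := by
  rw [invParity, map_mul, Equiv.Perm.mul_apply, signedConjHom_apply, signedConjHom_apply, zero_add]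

theorem invParity_simple_self (i : S) : cs.invParity (cs.simple i) (cs.simple i) = 1 := by
  classical
  have := cs.invParity_wordProd [i] (cs.simple i)
  simpa using this

theorem invParity_one (t : W) : cs.invParity 1 t = 0 := by
  classical
  have := cs.invParity_wordProd [] t
  simpa using this

/-- With `t = w s w⁻¹`, the cocycle rule applied to `w w⁻¹ = 1` makes the contributions of `w` and
`w⁻¹` cancel; only that of `s` at itself remains. -/
theorem invParity_self {t : W} (ht : cs.IsReflection t) : cs.invParity t t = 1 := by
  obtain ⟨w, i, rfl⟩ := ht
  have h := cs.invParity_mul w w⁻¹ (w * cs.simple i * w⁻¹)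
  rw [mul_inv_cancel, invParity_one] at h
  rw [mul_assoc w, invParity_mul, invParity_mul]
  simp only [mul_assoc, inv_inv, inv_mul_cancel_left, inv_mul_cancel, mul_one,
    simple_mul_simple_cancel_left, cs.inv_simple, invParity_simple_self, mul_inv_rev] at h ⊢
  rw [add_right_comm, ← h, zero_add]

theorem length_mul_lt_of_invParity {w t : W} (h : cs.invParity w t = 1) :
    cs.length (w * t) < cs.length w := by
  classical
  obtain ⟨ω, hω, rfl⟩ := cs.exists_isReduced w
  rw [invParity_wordProd] at h
  have hmem : t ∈ cs.rightInvSeq ω := by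
    by_contra hn
    rw [List.count_eq_zero_of_not_mem hn] at h
    simp at h
  exact (cs.isRightInversion_of_mem_rightInvSeq hω hmem).2

/-- For the converse, exactly one of `w` and `w t` has odd parity at `t`; if it were `w t`, then `w
= (w t) t` would be the shorter one. -/
theorem invParity_eq_one_iff {w t : W} (ht : cs.IsReflection t) :
    cs.invParity w t = 1 ↔ cs.length (w * t) < cs.length w := by
  refine ⟨cs.length_mul_lt_of_invParity, fun h => ?_⟩
  by_contra hn
  have h0 : cs.invParity w t = 0 := by
    generalize cs.invParity w t = x at hn
    revert x; decide
  have h1 : cs.invParity (w * t) t = 1 := by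
    rw [invParity_mul, cs.invParity_self ht, mul_inv_cancel_right, h0, add_zero]
  have h2 := cs.length_mul_lt_of_invParity h1
  rw [mul_assoc, ht.mul_self, mul_one] at h2
  omega

/-- The strong exchange condition: the right inversions of an element occur in the right inversion
sequence of each of its words. -/
theorem mem_rightInvSeq_of_length_mul_lt {ω : List S} {t : W} (ht : cs.IsReflection t)
    (h : cs.length (cs.wordProd ω * t) < cs.length (cs.wordProd ω)) : t ∈ cs.rightInvSeq ω := by
  classical
  rw [← cs.invParity_eq_one_iff ht, invParity_wordProd] at h
  by_contra hn
  rw [List.count_eq_zero_of_not_mem hn] at h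
  simp at h

theorem mem_leftInvSeq_of_length_mul_lt {ω : List S} {t : W} (ht : cs.IsReflection t)
    (h : cs.length (t * cs.wordProd ω) < cs.length (cs.wordProd ω)) : t ∈ cs.leftInvSeq ω := by
  have h' : t ∈ cs.rightInvSeq ω.reverse := by
    refine cs.mem_rightInvSeq_of_length_mul_lt ht ?_
    rw [cs.wordProd_reverse, ← cs.length_inv, cs.length_inv (cs.wordProd ω), mul_inv_rev, inv_inv,
      ht.inv]
    exact h
  rwa [cs.rightInvSeq_reverse, List.mem_reverse] at h'

end CoxeterSystem

/-! ### The geometric representation and the orders of products of two generators -/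

namespace CoxeterMatrix

variable {S : Type*} (M : CoxeterMatrix S)

/-- Twice the canonical bilinear form of a Coxeter matrix. -/
noncomputable def cosForm (i j : S) : ℝ := -2 * Real.cos (Real.pi / M i j)

theorem cosForm_self (i : S) : M.cosForm i i = 2 := by simp [cosForm]

theorem cosForm_comm (i j : S) : M.cosForm i j = M.cosForm j i := by
  simp [cosForm, M.symmetric i j]

/-- The reflections of the contragredient geometric representation. -/
noncomputable def geomReflection (i : S) : Module.End ℝ (S → ℝ) where
  toFun f := fun j => f j - M.cosForm i j * f i
  map_add' f g := by ext j; simp; ring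
  map_smul' c f := by ext j; simp; ring

theorem geomReflection_apply (i j : S) (f : S → ℝ) :
    M.geomReflection i f j = f j - M.cosForm i j * f i := rfl

theorem geomReflection_of_eq_zero (i : S) {f : S → ℝ} (h : f i = 0) :
    M.geomReflection i f = f := by
  ext j; simp [geomReflection_apply, h]

theorem geomReflection_mul_self (i : S) : M.geomReflection i * M.geomReflection i = 1 := by
  ext f j
  simp only [Module.End.mul_apply, geomReflection_apply, cosForm_self, Module.End.one_apply]
  ring

/-- A parametrization of the plane in which the product of two reflections is a rotation. -/
noncomputable def planeVec (i j : S) (φ : ℝ) : S → ℝ := fun k =>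
  Real.cos (Real.pi / M i j - φ) * M.cosForm i k + Real.cos φ * M.cosForm j k

theorem planeVec_left (i j : S) (φ : ℝ) :
    M.planeVec i j φ i = 2 * Real.sin (Real.pi / M i j) * Real.sin φ := by
  rw [planeVec, cosForm_self, M.cosForm_comm, cosForm, Real.cos_sub]; ring

theorem planeVec_right (i j : S) (φ : ℝ) :
    M.planeVec i j φ j = 2 * Real.sin (Real.pi / M i j) * Real.sin (Real.pi / M i j - φ) := by
  rw [planeVec, cosForm_self, cosForm, Real.cos_sub, Real.sin_sub]
  linear_combination (-2 * Real.cos φ) * Real.sin_sq_add_cos_sq (Real.pi / M i j)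

theorem geomReflection_planeVec_left (i j : S) (φ : ℝ) :
    M.geomReflection i (M.planeVec i j φ) = M.planeVec i j (-φ) := by
  ext k
  rw [geomReflection_apply, planeVec_left]
  simp only [planeVec, sub_neg_eq_add, Real.cos_neg, Real.cos_add, Real.cos_sub]
  ring

theorem geomReflection_planeVec_right (i j : S) (φ : ℝ) :
    M.geomReflection j (M.planeVec i j φ) = M.planeVec i j (2 * (Real.pi / M i j) - φ) := by
  ext k
  rw [geomReflection_apply, planeVec_right]
  have h1 : Real.pi / M i j - (2 * (Real.pi / M i j) - φ) = -(Real.pi / M i j - φ) := by ring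
  have h2 : Real.cos (2 * (Real.pi / M i j) - φ) = Real.cos φ -
      2 * Real.sin (Real.pi / M i j) * Real.sin (Real.pi / M i j - φ) := by
    rw [show 2 * (Real.pi / M i j) - φ = Real.pi / M i j + (Real.pi / M i j - φ) by ring,
      Real.cos_add]
    nth_rewrite 3 [show φ = Real.pi / M i j - (Real.pi / M i j - φ) by ring]
    rw [Real.cos_sub (Real.pi / M i j) (Real.pi / M i j - φ)]
    ring
  simp only [planeVec, h1, h2, Real.cos_neg]
  ring

/-- The reflections act on the angle by `φ ↦ -φ` and `φ ↦ 2π/m - φ`, so their product is a rotation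
by `-2π/m`. -/
theorem geomReflection_mul_pow_planeVec (i j : S) (k : ℕ) (φ : ℝ) :
    ((M.geomReflection i * M.geomReflection j) ^ k) (M.planeVec i j φ) =
      M.planeVec i j (φ - k * (2 * (Real.pi / M i j))) := by
  induction k with
  | zero => simp
  | succ k ih =>
    rw [pow_succ', Module.End.mul_apply, ih, Module.End.mul_apply, geomReflection_planeVec_right,
      geomReflection_planeVec_left]
    congr 1
    push_cast
    ring

theorem sin_pi_div_pos {i j : S} (hij : i ≠ j) (h0 : M i j ≠ 0) :
    0 < Real.sin (Real.pi / M i j) := by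
  have h1 : M i j ≠ 1 := M.off_diagonal i j hij
  have h2 : (2 : ℝ) ≤ M i j := by exact_mod_cast (by omega : 2 ≤ M i j)
  apply Real.sin_pos_of_pos_of_lt_pi
  · have := Real.pi_pos; positivity
  · rw [div_lt_iff₀ (by linarith)]
    nlinarith [Real.pi_pos]

/-- For finite `m`, every function is a planar vector, on which the product rotates with `m`-th
power trivial, plus a function vanishing at `i` and `j`, which both reflections fix. -/
theorem geomReflection_isLiftable : M.IsLiftable M.geomReflection := by
  intro i j
  by_cases hij : i = j
  · subst hij; rw [geomReflection_mul_self, one_pow]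
  by_cases h0 : M i j = 0
  · rw [h0, pow_zero]
  have hs := M.sin_pi_div_pos hij h0
  have hm : (M i j : ℝ) ≠ 0 := by exact_mod_cast h0
  have hvec : ∀ φ, ((M.geomReflection i * M.geomReflection j) ^ M i j) (M.planeVec i j φ) =
      M.planeVec i j φ := by
    intro φ
    rw [geomReflection_mul_pow_planeVec]
    have h1 : φ - (M i j : ℝ) * (2 * (Real.pi / M i j)) = φ - 2 * Real.pi := by
      field_simp
    have h2 : Real.pi / M i j - (φ - 2 * Real.pi) = (Real.pi / M i j - φ) + 2 * Real.pi := by ring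
    ext k
    rw [h1, planeVec, planeVec, h2, Real.cos_add_two_pi, Real.cos_sub_two_pi]
  have hfix : ∀ f : S → ℝ, f i = 0 → f j = 0 →
      ((M.geomReflection i * M.geomReflection j) ^ M i j) f = f := by
    intro f hi hj
    generalize M i j = n
    induction n with
    | zero => simp
    | succ n ih =>
      rw [pow_succ, Module.End.mul_apply, Module.End.mul_apply, geomReflection_of_eq_zero _ _ hj,
        geomReflection_of_eq_zero _ _ hi, ih]
  refine LinearMap.ext fun f => ?_
  set s := Real.sin (Real.pi / M i j) with hsdef
  -- The planar vector at angle `0` has coordinates `0` and `2s²` at `i` and `j`, and the one at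
  -- angle `π/2` has coordinate `2s` at `i`. The system for the planar part of `f` is thus
  -- triangular.
  obtain ⟨y, hy⟩ : ∃ y : ℝ, y = f i / (2 * s) := ⟨_, rfl⟩
  obtain ⟨x, hx⟩ : ∃ x : ℝ, x = (f j - y * M.planeVec i j (Real.pi / 2) j) / (2 * s * s) :=
    ⟨_, rfl⟩
  have hg := hfix (f - (x • M.planeVec i j 0 + y • M.planeVec i j (Real.pi / 2)))
    (by
      simp only [Pi.sub_apply, Pi.add_apply, Pi.smul_apply, planeVec_left, smul_eq_mul,
        Real.sin_zero, Real.sin_pi_div_two, ← hsdef, hy]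
      field_simp; ring)
    (by
      simp only [Pi.sub_apply, Pi.add_apply, Pi.smul_apply, smul_eq_mul]
      rw [hx, M.planeVec_right i j 0, sub_zero, ← hsdef]
      field_simp; ring)
  rw [map_sub, map_add, map_smul, map_smul, hvec, hvec] at hg
  rw [Module.End.one_apply]
  exact sub_left_injective hg

end CoxeterMatrix

namespace CoxeterSystem

variable {S : Type*} {W : Type*} [Group W] {M : CoxeterMatrix S} (cs : CoxeterSystem M W)

/-- The order of the product of two distinct simple reflections is the entry of the Coxeter
matrix. -/
theorem dvd_of_simple_mul_simple_pow_eq_one {i j : S} (hij : i ≠ j) {k : ℕ}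
    (h : (cs.simple i * cs.simple j) ^ k = 1) : M i j ∣ k := by
  have hρ := congrArg (cs.lift ⟨M.geomReflection, M.geomReflection_isLiftable⟩) h
  rw [map_pow, map_mul, cs.lift_apply_simple, cs.lift_apply_simple, map_one] at hρ
  by_cases h0 : M i j = 0
  · have hb : M.cosForm i j = -2 := by simp [CoxeterMatrix.cosForm, h0]
    -- When the entry is infinite the product acts unipotently: `f i + f j` is invariant and, when
    -- it equals 1, each application lowers `f i` by 2.
    have key : ∀ n : ℕ, ∀ f : S → ℝ, f i + f j = 1 →
        ((M.geomReflection i * M.geomReflection j) ^ n) f i = f i - 2 * n ∧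
        ((M.geomReflection i * M.geomReflection j) ^ n) f i +
          ((M.geomReflection i * M.geomReflection j) ^ n) f j = 1 := by
      intro n f hf
      induction n with
      | zero => simp [hf]
      | succ n ih =>
        rw [pow_succ', Module.End.mul_apply, Module.End.mul_apply]
        simp only [M.geomReflection_apply, M.cosForm_self, M.cosForm_comm j i, hb]
        push_cast
        obtain ⟨h1, h2⟩ := ih
        constructor <;> linarith
    classical
    have := (key k (Pi.single j 1) (by simp [hij])).1
    rw [hρ, Module.End.one_apply] at this
    have hk : (k : ℝ) = 0 := by linarith
    rw [h0, Nat.cast_eq_zero.mp hk]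
  · have hs := M.sin_pi_div_pos hij h0
    -- The vector at angle `0` is fixed by a rotation through `2πk/m`: coordinate `i` gives a
    -- vanishing sine, coordinate `j` a cosine equal to 1.
    have h1 := M.geomReflection_mul_pow_planeVec i j k 0
    rw [hρ, Module.End.one_apply] at h1
    have hi := congrFun h1 i
    have hj := congrFun h1 j
    rw [M.planeVec_left, M.planeVec_left, mul_right_inj' (by positivity), zero_sub, Real.sin_neg,
      Real.sin_zero, zero_eq_neg] at hi
    rw [M.planeVec_right, M.planeVec_right, mul_right_inj' (by positivity), zero_sub, sub_zero,
      sub_neg_eq_add, Real.sin_add, hi, mul_zero, add_zero] at hj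
    have hc : Real.cos (k * (2 * (Real.pi / M i j))) = 1 :=
      (mul_left_cancel₀ hs.ne' (by rw [mul_one]; exact hj)).symm
    obtain ⟨n, hn⟩ := (Real.cos_eq_one_iff _).mp hc
    have hm : (M i j : ℝ) ≠ 0 := by exact_mod_cast h0
    have h3 : (n : ℝ) * M i j = k := by
      field_simp at hn
      linarith
    have h4 : (k : ℤ) = M i j * n := by
      have : (n : ℤ) * M i j = k := by exact_mod_cast h3
      linarith
    exact Int.natCast_dvd_natCast.mp ⟨n, h4⟩

end CoxeterSystem

/-! ### Alternated products -/

theorem altProd_two_mul {N : Type*} [Monoid N] (p : ℕ) (a b : N) :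
    altProd (2 * p) a b = (a * b) ^ p := by
  induction p with
  | zero => simp [altProd]
  | succ p ih =>
    rw [show 2 * (p + 1) = 2 * p + 1 + 1 by ring, altProd, altProd, ih, pow_succ', mul_assoc]

theorem altProd_two_mul_add_one {N : Type*} [Monoid N] (p : ℕ) (a b : N) :
    altProd (2 * p + 1) a b = (a * b) ^ p * a := by
  rw [altProd, altProd_two_mul, mul_pow_mul]

/-- The alternated word `i j i j …` with `m` letters. -/
def altWord {S : Type*} : ℕ → S → S → List S
  | 0, _, _ => []
  | m + 1, i, j => i :: altWord m j i

theorem length_altWord {S : Type*} (m : ℕ) (i j : S) : (altWord m i j).length = m := by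
  induction m generalizing i j with
  | zero => rfl
  | succ m ih => simp [altWord, ih]

theorem prod_map_altWord {S N : Type*} [Monoid N] (f : S → N) (m : ℕ) (i j : S) :
    ((altWord m i j).map f).prod = altProd m (f i) (f j) := by
  induction m generalizing i j with
  | zero => rfl
  | succ m ih => simp [altWord, altProd, ih]

namespace CoxeterSystem

variable {S : Type*} {W : Type*} [Group W] {M : CoxeterMatrix S} (cs : CoxeterSystem M W)

/-- The alternated product of simple reflections with `m` factors. -/
abbrev altSimple (m : ℕ) (i j : S) : W := altProd m (cs.simple i) (cs.simple j)

theorem wordProd_altWord (m : ℕ) (i j : S) :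
    cs.wordProd (altWord m i j) = cs.altSimple m i j := prod_map_altWord _ _ _ _

theorem length_altSimple_le (m : ℕ) (i j : S) : cs.length (cs.altSimple m i j) ≤ m := by
  rw [← wordProd_altWord]
  exact (cs.length_wordProd_le _).trans_eq (length_altWord m i j)

theorem altSimple_comm (i j : S) : cs.altSimple (M i j) i j = cs.altSimple (M i j) j i := by
  have h := cs.simple_mul_simple_pow i j
  have hinv : ∀ p, ((cs.simple i * cs.simple j) ^ p)⁻¹ = (cs.simple j * cs.simple i) ^ p := by
    intro p; rw [← inv_pow, mul_inv_rev, cs.inv_simple, cs.inv_simple]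
  rcases Nat.even_or_odd' (M i j) with ⟨p, hp | hp⟩
  · rw [hp, two_mul, pow_add] at h
    rw [altSimple, altSimple, hp, altProd_two_mul, altProd_two_mul, ← hinv]
    exact eq_inv_of_mul_eq_one_left h
  · rw [hp, two_mul, pow_succ, pow_add] at h
    rw [altSimple, altSimple, hp, altProd_two_mul_add_one, altProd_two_mul_add_one, ← hinv,
      eq_inv_mul_iff_mul_eq, ← cs.inv_simple j]
    exact eq_inv_of_mul_eq_one_left (by simpa [mul_assoc] using h)

theorem exists_of_mem_leftInvSeq_altWord {k : ℕ} {i j : S} {t : W}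
    (ht : t ∈ cs.leftInvSeq (altWord k i j)) :
    ∃ p < k, t = (cs.simple i * cs.simple j) ^ p * cs.simple i := by
  induction k generalizing i j t with
  | zero => simp [altWord] at ht
  | succ k ih =>
    rw [altWord, leftInvSeq, List.mem_cons] at ht
    rcases ht with rfl | ht
    · exact ⟨0, by omega, by simp⟩
    · obtain ⟨t', ht', rfl⟩ := List.mem_map.mp ht
      obtain ⟨p, hp, rfl⟩ := ih ht'
      refine ⟨p + 1, by omega, ?_⟩
      rw [MulAut.conj_apply, cs.inv_simple, mul_pow_mul, pow_succ', mul_assoc, mul_assoc, mul_assoc,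
        mul_assoc, mul_pow_mul]

theorem mem_leftInvSeq_append {ω ω' : List S} {t : W} (ht : t ∈ cs.leftInvSeq (ω ++ ω')) :
    t ∈ cs.leftInvSeq ω ∨
      ∃ t' ∈ cs.leftInvSeq ω', t = cs.wordProd ω * t' * (cs.wordProd ω)⁻¹ := by
  induction ω generalizing t with
  | nil => exact Or.inr ⟨t, ht, by simp⟩
  | cons i ω ih =>
    rw [List.cons_append, leftInvSeq, List.mem_cons] at ht
    rw [leftInvSeq, List.mem_cons]
    rcases ht with rfl | ht
    · exact Or.inl (Or.inl rfl)
    · obtain ⟨t₁, ht₁, rfl⟩ := List.mem_map.mp ht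
      rcases ih ht₁ with h | ⟨t', ht', rfl⟩
      · exact Or.inl (Or.inr (List.mem_map.mpr ⟨t₁, h, rfl⟩))
      · exact Or.inr ⟨t', ht', by simp [wordProd_cons, mul_assoc]⟩

/-! ### The dihedral factor of an element with two descents -/

/-- Induction on `k` with the roles of `i` and `j` exchanged: given a factor of length `k` starting
with `j`, strong exchange deletes a letter when `i` is put in front. The letter cannot lie in the
dihedral factor, as that would bound the order of `sⱼ sᵢ` by `k < M i j`; so it is deleted from the
cofactor. -/
theorem exists_eq_altSimple_mul {u : W} {i j : S} (hij : i ≠ j) (hi : cs.IsLeftDescent u i)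
    (hj : cs.IsLeftDescent u j) (k : ℕ) (hk : M i j = 0 ∨ k ≤ M i j) :
    ∃ c, u = cs.altSimple k i j * c ∧ cs.length u = k + cs.length c := by
  induction k generalizing i j with
  | zero => exact ⟨u, by simp [altProd], by simp⟩
  | succ k ih =>
    obtain ⟨c, hc, hlc⟩ := ih hij.symm hj hi (by rw [M.symmetric]; omega)
    obtain ⟨ω, hω, rfl⟩ := cs.exists_isReduced c
    have hu : u = cs.wordProd (altWord k j i ++ ω) := by
      rw [wordProd_append, wordProd_altWord, hc]
    have hmem := cs.mem_leftInvSeq_of_length_mul_lt (cs.isReflection_simple i)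
      (by rw [← hu]; exact hi : cs.length (cs.simple i * cs.wordProd (altWord k j i ++ ω)) <
        cs.length (cs.wordProd (altWord k j i ++ ω)))
    rcases cs.mem_leftInvSeq_append hmem with h | ⟨t, ht, hit⟩
    · obtain ⟨p, hp, h⟩ := cs.exists_of_mem_leftInvSeq_altWord h
      have h1 : (cs.simple j * cs.simple i) ^ (p + 1) = 1 := by
        rw [pow_succ, ← mul_assoc, ← h, cs.simple_mul_simple_self]
      have h2 := cs.dvd_of_simple_mul_simple_pow_eq_one hij.symm h1
      rw [M.symmetric] at h2
      rcases hk with hk | hk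
      · rw [hk] at h2; simp at h2
      · have := Nat.le_of_dvd (by omega) h2; omega
    · have h1 := (cs.isLeftInversion_of_mem_leftInvSeq hω ht).2
      rw [wordProd_altWord] at hit
      have h2 : u = cs.altSimple (k + 1) i j * (t * cs.wordProd ω) := by
        have : cs.simple i * u = cs.altSimple k j i * (t * cs.wordProd ω) := by
          rw [hit, hc]; simp [mul_assoc]
        rw [altSimple, altProd, mul_assoc, ← this, cs.simple_mul_simple_cancel_left]
      refine ⟨_, h2, ?_⟩
      have h3 := cs.length_mul_le (cs.altSimple (k + 1) i j) (t * cs.wordProd ω)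
      rw [← h2] at h3
      have h4 := cs.length_altSimple_le (k + 1) i j
      omega

/-- With an infinite entry, `u` would have a dihedral factor longer than itself. -/
theorem ne_zero_of_isLeftDescent {u : W} {i j : S} (hij : i ≠ j) (hi : cs.IsLeftDescent u i)
    (hj : cs.IsLeftDescent u j) : M i j ≠ 0 := by
  intro h0
  obtain ⟨c, -, h⟩ := cs.exists_eq_altSimple_mul hij hi hj (cs.length u + 1) (Or.inl h0)
  omega

/-! ### The weak order -/

/-- The lengths of `x` and `y` add up in the product `x * y`. -/
def LengthAdd (x y : W) : Prop := cs.length (x * y) = cs.length x + cs.length y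

/-- The weak order: `x` is a prefix of `y`. -/
def IsPrefix (x y : W) : Prop := cs.LengthAdd x (x⁻¹ * y)

variable {cs}

theorem isPrefix_iff {x y : W} :
    cs.IsPrefix x y ↔ cs.length y = cs.length x + cs.length (x⁻¹ * y) := by
  rw [IsPrefix, LengthAdd, mul_inv_cancel_left]

theorem LengthAdd.isPrefix {x y : W} (h : cs.LengthAdd x y) : cs.IsPrefix x (x * y) := by
  rwa [IsPrefix, inv_mul_cancel_left]

theorem isPrefix_refl (x : W) : cs.IsPrefix x x := by simp [isPrefix_iff]

theorem isPrefix_one (x : W) : cs.IsPrefix 1 x := by simp [isPrefix_iff]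

theorem IsPrefix.length_le {x y : W} (h : cs.IsPrefix x y) : cs.length x ≤ cs.length y := by
  rw [isPrefix_iff] at h; omega

theorem IsPrefix.trans {x y z : W} (h : cs.IsPrefix x y) (h' : cs.IsPrefix y z) :
    cs.IsPrefix x z := by
  rw [isPrefix_iff] at *
  have h1 := cs.length_mul_le (x⁻¹ * y) (y⁻¹ * z)
  have h2 := cs.length_mul_le x (x⁻¹ * z)
  rw [mul_assoc, mul_inv_cancel_left] at h1
  rw [mul_inv_cancel_left] at h2
  omega

theorem IsPrefix.eq_of_length_le {x y : W} (h : cs.IsPrefix x y)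
    (hl : cs.length y ≤ cs.length x) : x = y := by
  rw [isPrefix_iff] at h
  exact (inv_mul_eq_one.mp (cs.length_eq_zero_iff.mp (by omega)))

theorem IsPrefix.antisymm {x y : W} (h : cs.IsPrefix x y) (h' : cs.IsPrefix y x) : x = y :=
  h.eq_of_length_le h'.length_le

theorem LengthAdd.of_isPrefix {x y z : W} (h : cs.LengthAdd x z) (hy : cs.IsPrefix y z) :
    cs.LengthAdd x y := by
  rw [isPrefix_iff] at hy
  rw [LengthAdd] at *
  have h1 := cs.length_mul_le (x * y) (y⁻¹ * z)
  have h2 := cs.length_mul_le x y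
  rw [mul_assoc, mul_inv_cancel_left] at h1
  omega

theorem IsPrefix.mul_left_iff {x y z : W} (hy : cs.LengthAdd x y) (hz : cs.LengthAdd x z) :
    cs.IsPrefix (x * y) (x * z) ↔ cs.IsPrefix y z := by
  rw [isPrefix_iff, isPrefix_iff, mul_inv_rev, mul_assoc, inv_mul_cancel_left, hy, hz]
  omega

/-- An element above `z` in the weak order has the form `z y`. -/
theorem IsPrefix.exists_lengthAdd {x z : W} (h : cs.IsPrefix x z) :
    ∃ y, z = x * y ∧ cs.LengthAdd x y := ⟨x⁻¹ * z, by simp, h⟩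

theorem LengthAdd.assoc_right {x y z : W} (h : cs.LengthAdd x y) (h' : cs.LengthAdd (x * y) z) :
    cs.LengthAdd x (y * z) ∧ cs.LengthAdd y z := by
  simp only [LengthAdd] at *
  have h1 := cs.length_mul_le x (y * z)
  have h2 := cs.length_mul_le y z
  rw [← mul_assoc] at h1 ⊢
  omega

theorem isPrefix_simple_iff {i : S} {x : W} :
    cs.IsPrefix (cs.simple i) x ↔ cs.IsLeftDescent x i := by
  rw [isPrefix_iff, cs.isLeftDescent_iff, cs.inv_simple, cs.length_simple]
  omega

theorem lengthAdd_simple_iff {i : S} {x : W} :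
    cs.LengthAdd (cs.simple i) x ↔ ¬ cs.IsLeftDescent x i := by
  rw [LengthAdd, cs.not_isLeftDescent_iff, cs.length_simple]
  omega

theorem IsPrefix.exists_simple {x y : W} (h : cs.IsPrefix x y) (hne : x ≠ y) :
    ∃ i, cs.LengthAdd x (cs.simple i) ∧ cs.IsPrefix (x * cs.simple i) y := by
  obtain ⟨z, rfl, hz⟩ := h.exists_lengthAdd
  obtain ⟨i, hi⟩ := cs.exists_leftDescent_of_ne_one (w := z) (by rintro rfl; simp at hne)
  have hi' : cs.IsPrefix (cs.simple i) z := isPrefix_simple_iff.mpr hi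
  have := hz.of_isPrefix hi'
  exact ⟨i, this, (IsPrefix.mul_left_iff this hz).mpr hi'⟩

theorem isPrefix_altSimple {i j : S} (hij : i ≠ j) {u : W} (hi : cs.IsPrefix (cs.simple i) u)
    (hj : cs.IsPrefix (cs.simple j) u) : cs.IsPrefix (cs.altSimple (M i j) i j) u ∧
      cs.length (cs.altSimple (M i j) i j) = M i j := by
  rw [isPrefix_simple_iff] at hi hj
  obtain ⟨c, hc, hl⟩ := cs.exists_eq_altSimple_mul hij hi hj (M i j) (Or.inr le_rfl)
  have h1 := cs.length_altSimple_le (M i j) i j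
  have h2 := cs.length_mul_le (cs.altSimple (M i j) i j) c
  rw [← hc] at h2
  refine ⟨?_, by omega⟩
  rw [isPrefix_iff]
  nth_rewrite 2 [hc]
  rw [inv_mul_cancel_left]
  omega

theorem isPrefix_simple_altSimple {i j : S} (h0 : M i j ≠ 0)
    (hl : cs.length (cs.altSimple (M i j) i j) = M i j) :
    cs.IsPrefix (cs.simple i) (cs.altSimple (M i j) i j) := by
  obtain ⟨m, hm⟩ := Nat.exists_eq_succ_of_ne_zero h0
  have h1 := cs.length_altSimple_le m j i
  rw [isPrefix_simple_iff, IsLeftDescent, hl]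
  rw [altSimple] at h1
  rw [hm, altSimple, altProd, cs.simple_mul_simple_cancel_left]
  omega

/-- Two distinct covers of `z` below `u` have an upper bound below `u` which depends only on the
covers. -/
theorem IsPrefix.diamond {z u : W} {i j : S} (hij : i ≠ j)
    (hi : cs.LengthAdd z (cs.simple i)) (hj : cs.LengthAdd z (cs.simple j))
    (hzu : cs.IsPrefix z u)
    (hiu : cs.IsPrefix (z * cs.simple i) u) (hju : cs.IsPrefix (z * cs.simple j) u) :
    cs.IsPrefix (z * cs.altSimple (M i j) i j) u ∧
      cs.IsPrefix (z * cs.simple i) (z * cs.altSimple (M i j) i j) ∧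
      cs.IsPrefix (z * cs.simple j) (z * cs.altSimple (M i j) i j) := by
  obtain ⟨v, rfl, hv⟩ := hzu.exists_lengthAdd
  rw [IsPrefix.mul_left_iff hi hv] at hiu
  rw [IsPrefix.mul_left_iff hj hv] at hju
  obtain ⟨h1, h2⟩ := isPrefix_altSimple hij hiu hju
  have h0 : M i j ≠ 0 := cs.ne_zero_of_isLeftDescent hij (isPrefix_simple_iff.mp hiu)
    (isPrefix_simple_iff.mp hju)
  have hz := hv.of_isPrefix h1
  rw [IsPrefix.mul_left_iff hz hv, IsPrefix.mul_left_iff hi hz, IsPrefix.mul_left_iff hj hz]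
  refine ⟨h1, isPrefix_simple_altSimple h0 h2, ?_⟩
  rw [cs.altSimple_comm, M.symmetric] at h2 ⊢
  exact isPrefix_simple_altSimple (by rwa [M.symmetric]) h2

/-- Induction on the gap between the lengths of `z` and `u`. Two distinct covers of `z` below both
`u` and `v` have, by `IsPrefix.diamond`, a common upper bound still below both; hence the greatest
common prefixes above each cover coincide. -/
theorem exists_greatest_isPrefix_above {u v : W} (n : ℕ) : ∀ z : W,
    cs.length u ≤ cs.length z + n → cs.IsPrefix z u → cs.IsPrefix z v →
    ∃ m, cs.IsPrefix z m ∧ cs.IsPrefix m u ∧ cs.IsPrefix m v ∧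
      ∀ x, cs.IsPrefix z x → cs.IsPrefix x u → cs.IsPrefix x v → cs.IsPrefix x m := by
  induction n with
  | zero =>
    intro z hl hu hv
    have hzu := hu.eq_of_length_le hl
    exact ⟨z, isPrefix_refl z, hu, hv, fun x _ h _ => by rwa [hzu]⟩
  | succ n ih =>
    intro z hl hu hv
    have hcover : ∀ i, cs.LengthAdd z (cs.simple i) →
        cs.length u ≤ cs.length (z * cs.simple i) + n := by
      intro i hi; rw [hi, cs.length_simple]; omega
    by_cases hex : ∃ i, cs.LengthAdd z (cs.simple i) ∧ cs.IsPrefix (z * cs.simple i) u ∧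
        cs.IsPrefix (z * cs.simple i) v
    · obtain ⟨i, hi, hiu, hiv⟩ := hex
      obtain ⟨m, hm, hmu, hmv, hmax⟩ := ih _ (hcover i hi) hiu hiv
      refine ⟨m, hi.isPrefix.trans hm, hmu, hmv, fun x hx hxu hxv => ?_⟩
      by_cases hzx : z = x
      · rw [← hzx]; exact hi.isPrefix.trans hm
      obtain ⟨j, hj, hjx⟩ := hx.exists_simple hzx
      by_cases hij : i = j
      · subst hij; exact hmax x hjx hxu hxv
      have hju := hjx.trans hxu
      have hjv := hjx.trans hxv
      obtain ⟨m', hm', hmu', hmv', hmax'⟩ := ih _ (hcover j hj) hju hjv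
      obtain ⟨du, di, dj⟩ := IsPrefix.diamond hij hi hj hu hiu hju
      obtain ⟨dv, -, -⟩ := IsPrefix.diamond hij hi hj hv hiv hjv
      have h1 := hmax _ di du dv
      have h2 := hmax' _ dj du dv
      have e : m = m' :=
        (hmax' _ (dj.trans h1) hmu hmv).antisymm (hmax _ (di.trans h2) hmu' hmv')
      rw [e]
      exact hmax' x hjx hxu hxv
    · refine ⟨z, isPrefix_refl z, hu, hv, fun x hx hxu hxv => ?_⟩
      by_cases hzx : z = x
      · rw [hzx]; exact isPrefix_refl x
      obtain ⟨j, hj, hjx⟩ := hx.exists_simple hzx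
      exact absurd ⟨j, hj, hjx.trans hxu, hjx.trans hxv⟩ hex

theorem exists_greatest_isPrefix (u v : W) : ∃ m, cs.IsPrefix m u ∧ cs.IsPrefix m v ∧
    ∀ x, cs.IsPrefix x u → cs.IsPrefix x v → cs.IsPrefix x m := by
  obtain ⟨m, -, h1, h2, h3⟩ := exists_greatest_isPrefix_above (cs := cs) (u := u) (v := v)
    (cs.length u) 1 (by simp) (isPrefix_one u) (isPrefix_one v)
  exact ⟨m, h1, h2, fun x => h3 x (isPrefix_one x)⟩

variable (cs)

/-- The greatest common prefix. -/
noncomputable def meet (u v : W) : W :=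
  Classical.choose (exists_greatest_isPrefix (cs := cs) u v)

theorem meet_isPrefix_left (u v : W) : cs.IsPrefix (cs.meet u v) u :=
  (Classical.choose_spec (exists_greatest_isPrefix (cs := cs) u v)).1

theorem meet_isPrefix_right (u v : W) : cs.IsPrefix (cs.meet u v) v :=
  (Classical.choose_spec (exists_greatest_isPrefix (cs := cs) u v)).2.1

variable {cs} in
theorem IsPrefix.meet {x u v : W} (hu : cs.IsPrefix x u) (hv : cs.IsPrefix x v) :
    cs.IsPrefix x (cs.meet u v) :=
  (Classical.choose_spec (exists_greatest_isPrefix (cs := cs) u v)).2.2 x hu hv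

/-! ### The longest element -/

section Longest

variable [Finite W]

/-- An element of maximal length. -/
noncomputable def longest : W := Classical.choose (Finite.exists_max cs.length)

theorem length_le_longest (w : W) : cs.length w ≤ cs.length cs.longest :=
  Classical.choose_spec (Finite.exists_max cs.length) w

theorem invParity_longest_inv {t : W} (ht : cs.IsReflection t) :
    cs.invParity cs.longest⁻¹ t = 1 := by
  rw [cs.invParity_eq_one_iff ht]
  refine lt_of_le_of_ne ?_ (ht.length_mul_left_ne _)
  rw [cs.length_inv]
  exact cs.length_le_longest _

/-- All reflections are inversions of the longest element, so by the cocycle rule the left descents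
of `w * cs.longest` are exactly the non-descents of `w`. -/
theorem length_mul_longest (w : W) :
    cs.length (w * cs.longest) + cs.length w = cs.length cs.longest := by
  induction w using cs.simple_induction_left with
  | one => simp
  | mul_simple_left w i ih =>
    have hiff : cs.IsLeftDescent (w * cs.longest) i ↔ ¬ cs.IsLeftDescent w i := by
      rw [← cs.isRightDescent_inv_iff, ← cs.isRightDescent_inv_iff, IsRightDescent, IsRightDescent,
        ← cs.invParity_eq_one_iff (cs.isReflection_simple i),
        ← cs.invParity_eq_one_iff (cs.isReflection_simple i), mul_inv_rev, invParity_mul,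
        cs.invParity_longest_inv ((cs.isReflection_simple i).conj _)]
      generalize cs.invParity w⁻¹ (cs.simple i) = e
      revert e; decide
    rw [mul_assoc]
    by_cases h : cs.IsLeftDescent w i
    · have h1 := (cs.isLeftDescent_iff).mp h
      have h2 := (cs.not_isLeftDescent_iff).mp (fun h' => hiff.mp h' h)
      omega
    · have h1 := (cs.not_isLeftDescent_iff).mp h
      have h2 := (cs.isLeftDescent_iff).mp (hiff.mpr h)
      omega

theorem longest_mul_self : cs.longest * cs.longest = 1 := by
  have := cs.length_mul_longest cs.longest
  exact cs.length_eq_zero_iff.mp (by omega)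

theorem longest_inv : cs.longest⁻¹ = cs.longest :=
  inv_eq_of_mul_eq_one_left cs.longest_mul_self

theorem length_longest_mul (w : W) :
    cs.length (cs.longest * w) + cs.length w = cs.length cs.longest := by
  have := cs.length_mul_longest w⁻¹
  rw [cs.length_inv, ← cs.length_inv, mul_inv_rev, inv_inv, cs.longest_inv] at this
  exact this

theorem isPrefix_longest (w : W) : cs.IsPrefix w cs.longest := by
  have := cs.length_mul_longest w⁻¹
  rw [cs.length_inv] at this
  rw [isPrefix_iff]; omega

/-- This makes the elements that multiply `x` without loss of length a principal ideal of the weak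
order, so that the largest one below a given `v` is a meet. -/
theorem lengthAdd_iff_isPrefix {x z : W} :
    cs.LengthAdd x z ↔ cs.IsPrefix z (x⁻¹ * cs.longest) := by
  have h1 := cs.length_mul_longest x⁻¹
  have h2 := cs.length_mul_longest (x * z)⁻¹
  rw [cs.length_inv] at h1 h2
  rw [isPrefix_iff, LengthAdd, ← mul_assoc, ← mul_inv_rev]
  omega

theorem eq_longest_of_forall_isPrefix {w : W} (h : ∀ i, cs.IsPrefix (cs.simple i) w) :
    w = cs.longest := by
  have h1 : w * cs.longest = 1 := by
    by_contra hne
    obtain ⟨i, hi⟩ := cs.exists_leftDescent_of_ne_one hne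
    have h2 := isPrefix_simple_iff.mp (h i)
    have h3 := cs.length_mul_longest w
    have h4 := cs.length_mul_longest (cs.simple i * w)
    rw [IsLeftDescent] at hi h2
    rw [mul_assoc] at h4
    omega
  rw [← cs.longest_inv]
  exact eq_inv_of_mul_eq_one_left h1

theorem length_altSimple {i j : S} (hij : i ≠ j) :
    cs.length (cs.altSimple (M i j) i j) = M i j :=
  (isPrefix_altSimple hij (cs.isPrefix_longest _) (cs.isPrefix_longest _)).2

theorem exists_longest_mul_simple_mul_longest (i : S) :
    ∃ j, cs.longest * cs.simple i * cs.longest = cs.simple j := by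
  have h1 := cs.length_mul_longest (cs.longest * cs.simple i)
  have h2 := cs.length_longest_mul (cs.simple i)
  rw [cs.length_simple] at h2
  exact cs.length_eq_one_iff.mp (by omega)

end Longest

end CoxeterSystem

/-! ### Artin–Tits monoids: words, degree and reversal -/

namespace CoxeterMatrix

variable {S : Type*} (M : CoxeterMatrix S)

theorem artinMonoid_induction {p : M.ArtinMonoid → Prop} (g : M.ArtinMonoid) (one : p 1)
    (gen_mul : ∀ i g, p g → p (M.artinGen i * g)) : p g := by
  induction g using PresentedMonoid.inductionOn with
  | h a =>
    induction a using FreeMonoid.inductionOn' with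
    | one => exact one
    | of_mul i a ih => rw [map_mul]; exact gen_mul i _ ih

theorem altProd_artinGen_comm {i j : S} (hij : i ≠ j) :
    altProd (M i j) (M.artinGen i) (M.artinGen j) =
      altProd (M i j) (M.artinGen j) (M.artinGen i) := by
  have := PresentedMonoid.mk_eq_mk_of_rel (rels := M.ArtinRel) ⟨i, j, hij, rfl, rfl⟩
  rwa [map_altProd, map_altProd] at this

/-- A homomorphism from the Artin–Tits monoid is given by the images of the generators. -/
def artinLift {N : Type*} [Monoid N] (f : S → N)
    (hf : ∀ i j, i ≠ j → altProd (M i j) (f i) (f j) = altProd (M i j) (f j) (f i)) :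
    M.ArtinMonoid →* N :=
  PresentedMonoid.lift f (by
    rintro u v ⟨i, j, hij, rfl, rfl⟩
    simpa only [map_altProd, FreeMonoid.lift_eval_of] using hf i j hij)

/-- The element of the Artin–Tits monoid represented by a word. -/
def artinWord (ω : List S) : M.ArtinMonoid := (ω.map M.artinGen).prod

theorem artinWord_nil : M.artinWord [] = 1 := rfl

theorem artinWord_cons (i : S) (ω : List S) :
    M.artinWord (i :: ω) = M.artinGen i * M.artinWord ω := by simp [artinWord]

theorem artinWord_append (ω ω' : List S) :
    M.artinWord (ω ++ ω') = M.artinWord ω * M.artinWord ω' := by simp [artinWord]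

theorem artinWord_altWord (m : ℕ) (i j : S) :
    M.artinWord (altWord m i j) = altProd m (M.artinGen i) (M.artinGen j) :=
  prod_map_altWord _ _ _ _

theorem artinWord_surjective : Function.Surjective M.artinWord := by
  intro g
  induction g using M.artinMonoid_induction with
  | one => exact ⟨[], rfl⟩
  | gen_mul i g ih =>
    obtain ⟨ω, rfl⟩ := ih
    exact ⟨i :: ω, M.artinWord_cons i ω⟩

/-- The length of an element of the Artin–Tits monoid with respect to the generators. -/
def degreeHom : M.ArtinMonoid →* Multiplicative ℕ :=
  M.artinLift (fun _ => Multiplicative.ofAdd 1) (fun _ _ _ => rfl)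

/-- The length of an element of the Artin–Tits monoid with respect to the generators. -/
def degree (g : M.ArtinMonoid) : ℕ := Multiplicative.toAdd (M.degreeHom g)

theorem degree_one : M.degree 1 = 0 := by simp [degree]

theorem degree_mul (g h : M.ArtinMonoid) : M.degree (g * h) = M.degree g + M.degree h := by
  simp [degree]

theorem degree_artinGen (i : S) : M.degree (M.artinGen i) = 1 := rfl

theorem degree_artinWord (ω : List S) : M.degree (M.artinWord ω) = ω.length := by
  induction ω with
  | nil => exact M.degree_one
  | cons i ω ih => rw [artinWord_cons, degree_mul, ih, degree_artinGen, List.length_cons, add_comm]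

theorem degree_pow (g : M.ArtinMonoid) (n : ℕ) : M.degree (g ^ n) = n * M.degree g := by
  simp [degree]

theorem eq_one_of_degree_eq_zero {g : M.ArtinMonoid} (h : M.degree g = 0) : g = 1 := by
  obtain ⟨ω, rfl⟩ := M.artinWord_surjective g
  rw [degree_artinWord, List.length_eq_zero_iff] at h
  rw [h, artinWord_nil]

theorem altProd_op {N : Type*} [Monoid N] {a b : N} {m : ℕ} (h : altProd m a b = altProd m b a) :
    altProd m (MulOpposite.op a) (MulOpposite.op b) =
      altProd m (MulOpposite.op b) (MulOpposite.op a) := by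
  rcases Nat.even_or_odd' m with ⟨p, rfl | rfl⟩
  · simp only [altProd_two_mul] at h ⊢
    rw [← MulOpposite.op_mul, ← MulOpposite.op_mul, ← MulOpposite.op_pow, ← MulOpposite.op_pow, h]
  · simp only [altProd_two_mul_add_one] at h ⊢
    rw [mul_pow_mul, mul_pow_mul] at h
    rw [← MulOpposite.op_mul, ← MulOpposite.op_mul, ← MulOpposite.op_pow, ← MulOpposite.op_pow,
      ← MulOpposite.op_mul, ← MulOpposite.op_mul, h]

/-- The reversing anti-automorphism, as a homomorphism to the opposite monoid. -/
def reverseHom : M.ArtinMonoid →* M.ArtinMonoidᵐᵒᵖ :=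
  M.artinLift (fun i => MulOpposite.op (M.artinGen i))
    (fun _ _ hij => altProd_op (M.altProd_artinGen_comm hij))

/-- The reversing anti-automorphism. -/
def reverse (g : M.ArtinMonoid) : M.ArtinMonoid := MulOpposite.unop (M.reverseHom g)

theorem reverse_one : M.reverse 1 = 1 := by simp [reverse]

theorem reverse_mul (g h : M.ArtinMonoid) : M.reverse (g * h) = M.reverse h * M.reverse g := by
  simp [reverse]

theorem reverse_artinGen (i : S) : M.reverse (M.artinGen i) = M.artinGen i := rfl

theorem reverse_pow (g : M.ArtinMonoid) (n : ℕ) : M.reverse (g ^ n) = M.reverse g ^ n := by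
  simp [reverse]

theorem reverse_reverse (g : M.ArtinMonoid) : M.reverse (M.reverse g) = g := by
  induction g using M.artinMonoid_induction with
  | one => simp [reverse_one]
  | gen_mul i g ih => rw [reverse_mul, reverse_mul, ih, reverse_artinGen, reverse_artinGen]

theorem reverse_artinWord (ω : List S) : M.reverse (M.artinWord ω) = M.artinWord ω.reverse := by
  induction ω with
  | nil => exact M.reverse_one
  | cons i ω ih =>
    rw [artinWord_cons, reverse_mul, ih, reverse_artinGen, List.reverse_cons, artinWord_append,
      artinWord_cons, artinWord_nil, mul_one]

end CoxeterMatrix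

/-! ### Matsumoto's theorem and the section from the Coxeter group -/

namespace CoxeterSystem

variable {S : Type*} {W : Type*} [Group W] {M : CoxeterMatrix S} (cs : CoxeterSystem M W)

theorem IsReduced.tail {cs : CoxeterSystem M W} {i : S} {ω : List S}
    (h : cs.IsReduced (i :: ω)) : cs.IsReduced ω := h.drop 1

theorem isReduced_append {ω ω' : List S} (h : cs.IsReduced ω) (h' : cs.IsReduced ω')
    (hl : cs.LengthAdd (cs.wordProd ω) (cs.wordProd ω')) : cs.IsReduced (ω ++ ω') := by
  rw [IsReduced, wordProd_append, hl, h, h', List.length_append]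

theorem IsReduced.lengthAdd {cs : CoxeterSystem M W} {ω ω' : List S}
    (h : cs.IsReduced (ω ++ ω')) :
    cs.IsReduced ω ∧ cs.IsReduced ω' ∧ cs.LengthAdd (cs.wordProd ω) (cs.wordProd ω') := by
  have h1 : cs.IsReduced ω := by simpa using h.take ω.length
  have h2 : cs.IsReduced ω' := by simpa using h.drop ω.length
  refine ⟨h1, h2, ?_⟩
  rw [LengthAdd, h1, h2, ← wordProd_append, h, List.length_append]

theorem isLeftDescent_of_isReduced_cons {i : S} {ω : List S} (h : cs.IsReduced (i :: ω)) :
    cs.IsLeftDescent (cs.wordProd (i :: ω)) i := by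
  rw [IsLeftDescent, h, wordProd_cons, simple_mul_simple_cancel_left, h.tail]
  simp

/-- **Matsumoto's theorem**: reduced words of the same element of a Coxeter group represent the
same element of the Artin–Tits monoid. -/
theorem artinWord_eq_of_isReduced (n : ℕ) : ∀ {ω ω' : List S}, ω.length = n → cs.IsReduced ω →
    cs.IsReduced ω' → cs.wordProd ω = cs.wordProd ω' → M.artinWord ω = M.artinWord ω' := by
  induction n with
  | zero =>
    intro ω ω' hn h h' he
    have : ω'.length = 0 := by rw [← h', ← he, h, hn]
    rw [List.length_eq_zero_iff.mp hn, List.length_eq_zero_iff.mp this]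
  | succ n ih =>
    intro ω ω' hn h h' he
    have hn' : ω'.length = n + 1 := by rw [← h', ← he, h, hn]
    obtain ⟨i, α, rfl⟩ := List.exists_cons_of_length_eq_add_one hn
    obtain ⟨j, β, rfl⟩ := List.exists_cons_of_length_eq_add_one hn'
    simp only [List.length_cons, Nat.add_right_cancel_iff] at hn hn'
    have hcancel : ∀ {k : S} {γ δ : List S}, γ.length = n → cs.IsReduced (k :: γ) →
        cs.IsReduced (k :: δ) → cs.wordProd (k :: γ) = cs.wordProd (k :: δ) →
        M.artinWord (k :: γ) = M.artinWord (k :: δ) := by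
      intro k γ δ hγ h1 h2 h3
      rw [wordProd_cons, wordProd_cons, mul_right_inj] at h3
      rw [M.artinWord_cons, M.artinWord_cons, ih hγ h1.tail h2.tail h3]
    by_cases hij : i = j
    · subst hij
      exact hcancel hn h h' he
    have hi := cs.isLeftDescent_of_isReduced_cons h
    have hj := cs.isLeftDescent_of_isReduced_cons h'
    rw [← he] at hj
    have h0 := cs.ne_zero_of_isLeftDescent hij hi hj
    -- Two intermediate reduced words, one starting with `i` and one with `j`, differ by a single
    -- braid relation; each is compared with the given word having the same first letter by
    -- induction.
    obtain ⟨c, hc, hlc⟩ := cs.exists_eq_altSimple_mul hij hi hj (M i j) (Or.inr le_rfl)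
    obtain ⟨γ, hγ, rfl⟩ := cs.exists_isReduced c
    have hc' := hc
    rw [cs.altSimple_comm] at hc'
    rw [← wordProd_altWord, ← wordProd_append] at hc hc'
    have hr : cs.IsReduced (altWord (M i j) i j ++ γ) := by
      rw [IsReduced, ← hc, hlc, hγ, List.length_append, length_altWord]
    have hr' : cs.IsReduced (altWord (M i j) j i ++ γ) := by
      rw [IsReduced, ← hc', hlc, hγ, List.length_append, length_altWord]
    have hbraid : M.artinWord (altWord (M i j) i j ++ γ) =
        M.artinWord (altWord (M i j) j i ++ γ) := by
      rw [M.artinWord_append, M.artinWord_append, M.artinWord_altWord, M.artinWord_altWord,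
        M.altProd_artinGen_comm hij]
    obtain ⟨m, hm⟩ := Nat.exists_eq_succ_of_ne_zero h0
    rw [hm] at hr hr' hbraid hc hc'
    simp only [altWord, List.cons_append] at hr hr' hbraid hc hc'
    rw [hcancel hn h hr hc, hbraid]
    refine hcancel ?_ hr' h' (hc'.symm.trans he)
    have := hr'.symm.trans (congrArg cs.length (hc'.symm.trans he) |>.trans h')
    simp only [List.length_cons, Nat.add_right_cancel_iff] at this
    rw [this, hn']

/-- The section from the Coxeter group to the Artin–Tits monoid given by reduced words. -/
noncomputable def toArtin (w : W) : M.ArtinMonoid :=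
  M.artinWord (Classical.choose (cs.exists_isReduced w))

theorem toArtin_wordProd {ω : List S} (h : cs.IsReduced ω) :
    cs.toArtin (cs.wordProd ω) = M.artinWord ω := by
  obtain ⟨h1, h2⟩ := Classical.choose_spec (cs.exists_isReduced (cs.wordProd ω))
  exact cs.artinWord_eq_of_isReduced _ rfl h1 h h2.symm

theorem toArtin_mul {x y : W} (h : cs.LengthAdd x y) :
    cs.toArtin (x * y) = cs.toArtin x * cs.toArtin y := by
  obtain ⟨ω, hω, rfl⟩ := cs.exists_isReduced x
  obtain ⟨ω', hω', rfl⟩ := cs.exists_isReduced y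
  rw [toArtin_wordProd _ hω, toArtin_wordProd _ hω', ← wordProd_append,
    toArtin_wordProd _ (cs.isReduced_append hω hω' h), M.artinWord_append]

theorem toArtin_one : cs.toArtin 1 = 1 := by
  have : cs.IsReduced [] := by simp [IsReduced]
  rw [← cs.wordProd_nil, cs.toArtin_wordProd this, M.artinWord_nil]

theorem toArtin_simple (i : S) : cs.toArtin (cs.simple i) = M.artinGen i := by
  have : cs.IsReduced [i] := by simp [IsReduced]
  rw [← cs.wordProd_singleton, cs.toArtin_wordProd this, M.artinWord_cons, M.artinWord_nil, mul_one]

theorem degree_toArtin (w : W) : M.degree (cs.toArtin w) = cs.length w := by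
  obtain ⟨ω, hω, rfl⟩ := cs.exists_isReduced w
  rw [toArtin_wordProd _ hω, M.degree_artinWord, hω]

theorem reverse_toArtin (w : W) : M.reverse (cs.toArtin w) = cs.toArtin w⁻¹ := by
  obtain ⟨ω, hω, rfl⟩ := cs.exists_isReduced w
  rw [toArtin_wordProd _ hω, M.reverse_artinWord, ← wordProd_reverse,
    toArtin_wordProd _ ((cs.isReduced_reverse_iff ω).mpr hω)]

/-- The canonical projection from the Artin–Tits monoid to the Coxeter group. -/
def artinProj : M.ArtinMonoid →* W :=
  M.artinLift cs.simple (fun i j _ => cs.altSimple_comm i j)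

theorem artinProj_artinWord (ω : List S) : cs.artinProj (M.artinWord ω) = cs.wordProd ω := by
  induction ω with
  | nil => simp [CoxeterMatrix.artinWord_nil]
  | cons i ω ih =>
    rw [M.artinWord_cons, map_mul, ih, wordProd_cons]; rfl

theorem artinProj_toArtin (w : W) : cs.artinProj (cs.toArtin w) = w := by
  obtain ⟨ω, hω, rfl⟩ := cs.exists_isReduced w
  rw [toArtin_wordProd _ hω, artinProj_artinWord]

/-- The factors of an element of the section belong to the section. -/
theorem eq_toArtin_of_mul_eq {w : W} {g h : M.ArtinMonoid} (e : cs.toArtin w = g * h) :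
    ∃ x y, g = cs.toArtin x ∧ h = cs.toArtin y ∧ cs.LengthAdd x y ∧ w = x * y := by
  obtain ⟨ω, rfl⟩ := M.artinWord_surjective g
  obtain ⟨ω', rfl⟩ := M.artinWord_surjective h
  rw [← M.artinWord_append] at e
  have h1 := congrArg cs.artinProj e
  have h2 := congrArg M.degree e
  rw [artinProj_toArtin, artinProj_artinWord] at h1
  rw [degree_toArtin, M.degree_artinWord] at h2
  have hr : cs.IsReduced (ω ++ ω') := by rw [IsReduced, ← h1, h2]
  obtain ⟨h3, h4, h5⟩ := hr.lengthAdd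
  exact ⟨_, _, (cs.toArtin_wordProd h3).symm, (cs.toArtin_wordProd h4).symm, h5,
    by rw [h1, wordProd_append]⟩

/-! ### The head and tail of an element of the Artin–Tits monoid -/

theorem meet_mul_left {x u v : W} (hu : cs.LengthAdd x u) (hv : cs.LengthAdd x v) :
    cs.meet (x * u) (x * v) = x * cs.meet u v := by
  obtain ⟨m, hm, hxm⟩ := (hu.isPrefix.meet hv.isPrefix).exists_lengthAdd
  have h1 := cs.meet_isPrefix_left (x * u) (x * v)
  have h2 := cs.meet_isPrefix_right (x * u) (x * v)
  have h3 := hu.of_isPrefix (cs.meet_isPrefix_left u v)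
  have h4 : cs.IsPrefix (x * cs.meet u v) (cs.meet (x * u) (x * v)) :=
    ((IsPrefix.mul_left_iff h3 hu).mpr (cs.meet_isPrefix_left u v)).meet
      ((IsPrefix.mul_left_iff h3 hv).mpr (cs.meet_isPrefix_right u v))
  rw [hm] at h1 h2 h4 ⊢
  rw [IsPrefix.mul_left_iff hxm hu] at h1
  rw [IsPrefix.mul_left_iff hxm hv] at h2
  rw [IsPrefix.mul_left_iff h3 hxm] at h4
  rw [(h1.meet h2).antisymm h4]

theorem meet_meet_of_isPrefix {u a b : W} (h : cs.IsPrefix b a) :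
    cs.meet (cs.meet u a) b = cs.meet u b := by
  have h1 := cs.meet_isPrefix_left (cs.meet u a) b
  have h2 := cs.meet_isPrefix_right (cs.meet u a) b
  have h3 := cs.meet_isPrefix_left u b
  have h4 := cs.meet_isPrefix_right u b
  exact ((h1.trans (cs.meet_isPrefix_left u a)).meet h2).antisymm
    ((h3.meet (h4.trans h)).meet h4)

section Finite

variable [Finite W]

/-- The greatest prefix `z` of `v` such that the lengths add up in `x * z`. -/
noncomputable def absorbed (x v : W) : W := cs.meet v (x⁻¹ * cs.longest)

theorem absorbed_isPrefix (x v : W) : cs.IsPrefix (cs.absorbed x v) v :=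
  cs.meet_isPrefix_left _ _

theorem lengthAdd_absorbed (x v : W) : cs.LengthAdd x (cs.absorbed x v) :=
  cs.lengthAdd_iff_isPrefix.mpr (cs.meet_isPrefix_right _ _)

theorem absorbed_one_left (v : W) : cs.absorbed 1 v = v := by
  refine (cs.absorbed_isPrefix 1 v).antisymm ((isPrefix_refl v).meet ?_)
  rw [inv_one, one_mul]
  exact cs.isPrefix_longest v

theorem absorbed_one_right (x : W) : cs.absorbed x 1 = 1 :=
  (cs.absorbed_isPrefix x 1).antisymm (isPrefix_one _)

/-- Absorbing into `y` and then into `x` agrees with absorbing into `x * y`: additivity gives `x⁻¹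
w₀ = y · ((x y)⁻¹ w₀)`, the common prefix `y` leaves the meet, and the nested meets collapse. -/
theorem absorbed_mul {x y : W} (h : cs.LengthAdd x y) (v : W) :
    cs.absorbed x (y * cs.absorbed y v) = y * cs.absorbed (x * y) v := by
  have hb := cs.lengthAdd_iff_isPrefix.mp h
  have e : x⁻¹ * cs.longest = y * ((x * y)⁻¹ * cs.longest) := by simp [mul_assoc]
  have hyb : cs.LengthAdd y ((x * y)⁻¹ * cs.longest) := by
    rw [IsPrefix, ← mul_assoc, ← mul_inv_rev] at hb; exact hb
  rw [absorbed, e, meet_mul_left _ (cs.lengthAdd_absorbed y v) hyb, absorbed,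
    meet_meet_of_isPrefix _ (cs.lengthAdd_iff_isPrefix.mp hyb), absorbed]

/-- The left action of `x` on pairs consisting of a head and a tail. -/
noncomputable def germAct (x : W) : Function.End (W × M.ArtinMonoid) := fun p =>
  (x * cs.absorbed x p.1, cs.toArtin ((cs.absorbed x p.1)⁻¹ * p.1) * p.2)

theorem germAct_apply (x v : W) (g : M.ArtinMonoid) : cs.germAct x (v, g) =
    (x * cs.absorbed x v, cs.toArtin ((cs.absorbed x v)⁻¹ * v) * g) := rfl

theorem germAct_one : cs.germAct 1 = 1 := by
  funext ⟨v, g⟩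
  rw [germAct_apply, absorbed_one_left, inv_mul_cancel, toArtin_one, one_mul, one_mul]
  rfl

theorem germAct_mul {x y : W} (h : cs.LengthAdd x y) :
    cs.germAct x * cs.germAct y = cs.germAct (x * y) := by
  funext ⟨v, g⟩
  change cs.germAct x (cs.germAct y (v, g)) = _
  have e := cs.absorbed_mul h v
  rw [germAct_apply, germAct_apply, germAct_apply, e, mul_assoc]
  refine Prod.ext rfl ?_
  change _ * (_ * g) = _ * g
  rw [← mul_assoc, ← toArtin_mul]
  · congr 2
    group
  · have h1 := isPrefix_iff.mp (cs.absorbed_isPrefix y v)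
    have h2 := isPrefix_iff.mp (cs.absorbed_isPrefix x (y * cs.absorbed y v))
    have h3 := isPrefix_iff.mp (cs.absorbed_isPrefix (x * y) v)
    have h4 : cs.length _ = _ := cs.lengthAdd_absorbed y v
    have h5 := (h.assoc_right (cs.lengthAdd_absorbed (x * y) v)).2
    rw [e] at h2
    rw [LengthAdd] at h5 ⊢
    dsimp only
    rw [show (y * cs.absorbed (x * y) v)⁻¹ * (y * cs.absorbed y v) *
      ((cs.absorbed y v)⁻¹ * v) = (cs.absorbed (x * y) v)⁻¹ * v by group]
    omega

theorem prod_map_germAct {ω : List S} (h : cs.IsReduced ω) :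
    (ω.map fun i => cs.germAct (cs.simple i)).prod = cs.germAct (cs.wordProd ω) := by
  induction ω with
  | nil => rw [wordProd_nil, germAct_one]; rfl
  | cons i ω ih =>
    have h' : cs.IsReduced ([i] ++ ω) := h
    have := h'.lengthAdd.2.2
    rw [wordProd_singleton] at this
    rw [List.map_cons, List.prod_cons, ih h.tail, germAct_mul _ this, wordProd_cons]

/-- The action of the Artin–Tits monoid on pairs consisting of a head and a tail. -/
noncomputable def germHom : M.ArtinMonoid →* Function.End (W × M.ArtinMonoid) :=
  M.artinLift (fun i => cs.germAct (cs.simple i)) (by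
    intro i j hij
    -- Both sides of a braid relation are reduced words because `W` is finite, so both act as
    -- `germAct` of the same element.
    have h := cs.length_altSimple hij
    have h1 : cs.IsReduced (altWord (M i j) i j) := by
      rw [IsReduced, wordProd_altWord, length_altWord, h]
    have h2 : cs.IsReduced (altWord (M i j) j i) := by
      rw [IsReduced, wordProd_altWord, length_altWord, ← altSimple_comm, h]
    have e1 := cs.prod_map_germAct h1
    have e2 := cs.prod_map_germAct h2
    rw [prod_map_altWord, wordProd_altWord] at e1 e2
    rw [e1, e2, altSimple_comm])

theorem germHom_toArtin (w : W) : cs.germHom (cs.toArtin w) = cs.germAct w := by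
  obtain ⟨ω, hω, rfl⟩ := cs.exists_isReduced w
  rw [toArtin_wordProd _ hω, ← cs.prod_map_germAct hω, CoxeterMatrix.artinWord, map_list_prod,
    List.map_map]
  rfl

/-- The greatest simple left divisor of an element, see `toArtin_dvd_iff`. -/
noncomputable def head (g : M.ArtinMonoid) : W := (cs.germHom g (1, 1)).1

/-- The complement of the greatest simple left divisor of an element. -/
noncomputable def tail (g : M.ArtinMonoid) : M.ArtinMonoid := (cs.germHom g (1, 1)).2

theorem head_toArtin_mul (w : W) (g : M.ArtinMonoid) :
    cs.head (cs.toArtin w * g) = w * cs.absorbed w (cs.head g) := by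
  rw [head, map_mul, germHom_toArtin]; rfl

theorem tail_toArtin_mul (w : W) (g : M.ArtinMonoid) :
    cs.tail (cs.toArtin w * g) =
      cs.toArtin ((cs.absorbed w (cs.head g))⁻¹ * cs.head g) * cs.tail g := by
  rw [tail, map_mul, germHom_toArtin]; rfl

theorem head_one : cs.head (1 : M.ArtinMonoid) = 1 := by rw [head, map_one]; rfl

theorem tail_one : cs.tail (1 : M.ArtinMonoid) = 1 := by rw [tail, map_one]; rfl

theorem head_toArtin (w : W) : cs.head (cs.toArtin w) = w := by
  have := cs.head_toArtin_mul w 1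
  rwa [mul_one, head_one, absorbed_one_right, mul_one] at this

/-- The head coordinate of `germAct` does not involve the tail. -/
theorem head_mul_congr (g : M.ArtinMonoid) {h h' : M.ArtinMonoid} (e : cs.head h = cs.head h') :
    cs.head (g * h) = cs.head (g * h') := by
  induction g using M.artinMonoid_induction with
  | one => simpa using e
  | gen_mul i g ih =>
    rw [mul_assoc, mul_assoc, ← cs.toArtin_simple, head_toArtin_mul, head_toArtin_mul, ih]

theorem toArtin_head_mul_tail (g : M.ArtinMonoid) : cs.toArtin (cs.head g) * cs.tail g = g := by
  induction g using M.artinMonoid_induction with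
  | one => rw [head_one, tail_one, toArtin_one, one_mul]
  | gen_mul i g ih =>
    rw [← cs.toArtin_simple, head_toArtin_mul, tail_toArtin_mul,
      toArtin_mul _ (cs.lengthAdd_absorbed _ _), mul_assoc, ← mul_assoc (cs.toArtin (cs.absorbed _ _)),
      ← toArtin_mul _ (cs.absorbed_isPrefix _ _), mul_inv_cancel_left, ih]

theorem toArtin_dvd_iff {w : W} {g : M.ArtinMonoid} :
    cs.toArtin w ∣ g ↔ cs.IsPrefix w (cs.head g) := by
  constructor
  · rintro ⟨h, rfl⟩
    rw [head_toArtin_mul]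
    exact (cs.lengthAdd_absorbed _ _).isPrefix
  · intro h
    obtain ⟨y, hy, hw⟩ := h.exists_lengthAdd
    refine ⟨cs.toArtin y * cs.tail g, ?_⟩
    rw [← mul_assoc, ← toArtin_mul _ hw, ← hy, toArtin_head_mul_tail]

/-- The right side depends only on the product `M.artinGen i * g`, so `g` is recovered from it; left
cancellation follows. -/
theorem eq_toArtin_mul_tail (i : S) (g : M.ArtinMonoid) :
    g = cs.toArtin (cs.simple i * cs.head (M.artinGen i * g)) * cs.tail (M.artinGen i * g) := by
  rw [← cs.toArtin_simple, head_toArtin_mul, tail_toArtin_mul, simple_mul_simple_cancel_left,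
    ← mul_assoc, ← toArtin_mul _ (cs.absorbed_isPrefix _ _), mul_inv_cancel_left,
    toArtin_head_mul_tail]

theorem artinMonoid_mul_left_cancel (cs : CoxeterSystem M W) {a b c : M.ArtinMonoid}
    (h : a * b = a * c) : b = c := by
  induction a using M.artinMonoid_induction with
  | one => simpa using h
  | gen_mul i a ih =>
    apply ih
    rw [mul_assoc, mul_assoc] at h
    rw [cs.eq_toArtin_mul_tail i (a * b), h, ← cs.eq_toArtin_mul_tail]

theorem artinMonoid_isCancelMul (cs : CoxeterSystem M W) : IsCancelMul M.ArtinMonoid where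
  mul_left_cancel _ _ _ h := cs.artinMonoid_mul_left_cancel h
  mul_right_cancel a b c h := by
    have h' := congrArg M.reverse h
    rw [M.reverse_mul, M.reverse_mul] at h'
    have := congrArg M.reverse (cs.artinMonoid_mul_left_cancel h')
    rwa [M.reverse_reverse, M.reverse_reverse] at this

end Finite

end CoxeterSystem

/-! ### Embedding a cancellative monoid with common left multiples into a group -/

/-- A left cancellative monoid in which any two elements have a common left multiple satisfies the
left Ore condition. -/
noncomputable abbrev oreSetTop {P : Type*} [Monoid P] [IsCancelMul P]
    (h : ∀ a b : P, ∃ c d, c * a = d * b) : OreLocalization.OreSet (⊤ : Submonoid P) where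
  ore_right_cancel r₁ r₂ s e := ⟨1, by rw [mul_right_cancel e]⟩
  oreNum r s := Classical.choose (Classical.choose_spec (h r s))
  oreDenom r s := ⟨Classical.choose (h r s), trivial⟩
  ore_eq r s := Classical.choose_spec (Classical.choose_spec (h r s))

universe u in
/-- A cancellative monoid with common left multiples embeds into a group. -/
theorem exists_injective_hom_units {P : Type u} [Monoid P] [IsCancelMul P]
    (h : ∀ a b : P, ∃ c d, c * a = d * b) :
    ∃ (O : Type u) (_ : Monoid O) (f : P →* Oˣ), Function.Injective f := by
  let := oreSetTop h
  let f : P →* (OreLocalization (⊤ : Submonoid P) P)ˣ :=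
    { toFun := fun g => OreLocalization.numeratorUnit ⟨g, trivial⟩
      map_one' := Units.ext (map_one OreLocalization.numeratorHom)
      map_mul' := fun a b => Units.ext (map_mul OreLocalization.numeratorHom a b) }
  refine ⟨_, _, f, fun a b e => ?_⟩
  have e' : (a /ₒ (1 : (⊤ : Submonoid P))) = b /ₒ (1 : (⊤ : Submonoid P)) := congrArg Units.val e
  obtain ⟨u, v, h1, h2⟩ := OreLocalization.oreDiv_eq_iff.mp e'
  have huv : (u : P) = v := by simpa using h2
  have h3 : (u : P) * b = v * a := h1
  rw [huv] at h3
  exact (mul_left_cancel h3).symm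

/-! ### The Garside element of an Artin–Tits monoid of spherical type -/

/-- Atoms belong to every generating set; hence every generator divides every Garside element. -/
theorem mem_of_mem_closure_of_irreducible {P : Type*} [Monoid P] [Subsingleton Pˣ] {D : Set P}
    {x : P} (hx : x ∈ Submonoid.closure D) (hirr : Irreducible x) : x ∈ D := by
  induction hx using Submonoid.closure_induction with
  | mem x h => exact h
  | one => exact absurd isUnit_one hirr.not_isUnit
  | mul x y _ _ ihx ihy =>
    rcases hirr.isUnit_or_isUnit rfl with h | h
    · rw [isUnit_iff_eq_one.mp h, one_mul] at hirr ⊢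
      exact ihy hirr
    · rw [isUnit_iff_eq_one.mp h, mul_one] at hirr ⊢
      exact ihx hirr

namespace CoxeterMatrix

variable {S : Type*} (M : CoxeterMatrix S)

theorem isRightDivisor_iff_reverse_dvd {s x : M.ArtinMonoid} :
    IsRightDivisor s x ↔ M.reverse s ∣ M.reverse x := by
  constructor
  · rintro ⟨c, rfl⟩
    exact ⟨M.reverse c, M.reverse_mul _ _⟩
  · rintro ⟨c, hc⟩
    refine ⟨M.reverse c, ?_⟩
    rw [← M.reverse_reverse x, hc, M.reverse_mul, M.reverse_reverse]

instance subsingleton_units : Subsingleton M.ArtinMonoidˣ where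
  allEq a b := by
    have h : ∀ u : M.ArtinMonoidˣ, u = 1 := by
      intro u
      have := congrArg M.degree u.mul_inv
      rw [degree_mul, degree_one] at this
      exact Units.ext (M.eq_one_of_degree_eq_zero (by omega))
    rw [h a, h b]

theorem irreducible_artinGen (i : S) : Irreducible (M.artinGen i) where
  not_isUnit h := by
    have := congrArg M.degree (isUnit_iff_eq_one.mp h)
    rw [degree_artinGen, degree_one] at this
    omega
  isUnit_or_isUnit a b h := by
    have := congrArg M.degree h
    rw [degree_artinGen, degree_mul] at this
    rcases Nat.eq_zero_or_pos (M.degree a) with ha | ha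
    · exact Or.inl (isUnit_iff_eq_one.mpr (M.eq_one_of_degree_eq_zero ha))
    · exact Or.inr (isUnit_iff_eq_one.mpr (M.eq_one_of_degree_eq_zero (by omega)))

/-- Atoms have degree at least 1, and a word in the generators attains the bound. -/
theorem atomNorm_eq_degree (x : M.ArtinMonoid) : atomNorm x = M.degree x := by
  apply le_antisymm
  · refine iSup₂_le ?_
    rintro l ⟨hl, rfl⟩
    rw [Nat.cast_le]
    induction l with
    | nil => simp
    | cons a l ih =>
      have h1 := ih fun b hb => hl b (List.mem_cons_of_mem a hb)
      have h2 : M.degree a ≠ 0 := fun h0 =>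
        (hl a List.mem_cons_self).not_isUnit (isUnit_iff_eq_one.mpr (M.eq_one_of_degree_eq_zero h0))
      rw [List.length_cons, List.prod_cons, degree_mul]
      omega
  · obtain ⟨ω, rfl⟩ := M.artinWord_surjective x
    have : ((ω.map M.artinGen).length : ℕ∞) ≤ atomNorm (M.artinWord ω) := by
      refine le_iSup₂_of_le (ω.map M.artinGen) ⟨?_, rfl⟩ le_rfl
      intro a ha
      obtain ⟨i, -, rfl⟩ := List.mem_map.mp ha
      exact M.irreducible_artinGen i
    rwa [List.length_map, ← M.degree_artinWord] at this

theorem exists_isGreatest_artinGen_pow_dvd (i : S) (z : M.ArtinMonoid) :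
    ∃ n, IsGreatest {m : ℕ | M.artinGen i ^ m ∣ z} n := by
  have hb : BddAbove {m : ℕ | M.artinGen i ^ m ∣ z} := by
    refine ⟨M.degree z, ?_⟩
    rintro m ⟨c, rfl⟩
    rw [M.degree_mul, M.degree_pow, M.degree_artinGen]
    omega
  exact ⟨_, Nat.sSup_mem ⟨0, by simp⟩ hb, fun m hm => le_csSup hb hm⟩

end CoxeterMatrix

namespace CoxeterSystem

variable {S : Type*} {W : Type*} [Group W] {M : CoxeterMatrix S} (cs : CoxeterSystem M W)
  [Finite W]

/-- The image of the longest element in the Artin–Tits monoid. -/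
noncomputable def delta : M.ArtinMonoid := cs.toArtin cs.longest

theorem toArtin_dvd_delta (w : W) : cs.toArtin w ∣ cs.delta := by
  rw [delta, toArtin_dvd_iff, head_toArtin]
  exact cs.isPrefix_longest w

theorem dvd_delta_iff {g : M.ArtinMonoid} : g ∣ cs.delta ↔ ∃ w, g = cs.toArtin w := by
  constructor
  · rintro ⟨h, hh⟩
    obtain ⟨x, -, hx, -⟩ := cs.eq_toArtin_of_mul_eq hh
    exact ⟨x, hx⟩
  · rintro ⟨w, rfl⟩
    exact cs.toArtin_dvd_delta w

theorem reverse_delta : M.reverse cs.delta = cs.delta := by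
  rw [delta, reverse_toArtin, longest_inv]

theorem isRightDivisor_delta_iff {g : M.ArtinMonoid} :
    IsRightDivisor g cs.delta ↔ ∃ w, g = cs.toArtin w := by
  rw [M.isRightDivisor_iff_reverse_dvd, reverse_delta, dvd_delta_iff]
  constructor
  · rintro ⟨w, hw⟩
    exact ⟨w⁻¹, by rw [← M.reverse_reverse g, hw, reverse_toArtin]⟩
  · rintro ⟨w, rfl⟩
    exact ⟨w⁻¹, cs.reverse_toArtin w⟩

theorem artinGen_dvd_delta (i : S) : M.artinGen i ∣ cs.delta :=
  cs.dvd_delta_iff.mpr ⟨_, (cs.toArtin_simple i).symm⟩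

theorem isGarsideElement_delta : IsGarsideElement cs.delta := by
  refine ⟨fun s => by rw [dvd_delta_iff, isRightDivisor_delta_iff], ?_, ?_⟩
  · rw [eq_top_iff]
    rintro g -
    induction g using M.artinMonoid_induction with
    | one => exact one_mem _
    | gen_mul i g ih => exact mul_mem (Submonoid.subset_closure (cs.artinGen_dvd_delta i)) ih
  · refine (Set.finite_range cs.toArtin).subset fun g hg => ?_
    obtain ⟨w, rfl⟩ := cs.dvd_delta_iff.mp hg
    exact ⟨w, rfl⟩

/-- The head of `g` lies above every simple reflection, which forces it to be the longest element.
-/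
theorem delta_dvd_of_forall_artinGen_dvd {g : M.ArtinMonoid} (h : ∀ i, M.artinGen i ∣ g) :
    cs.delta ∣ g := by
  have : cs.head g = cs.longest := cs.eq_longest_of_forall_isPrefix fun i => by
    rw [← toArtin_dvd_iff, toArtin_simple]; exact h i
  rw [delta, ← this]
  exact ⟨_, (cs.toArtin_head_mul_tail g).symm⟩

theorem delta_dvd_of_isGarsideElement {d : M.ArtinMonoid} (hd : IsGarsideElement d) :
    cs.delta ∣ d :=
  cs.delta_dvd_of_forall_artinGen_dvd fun i =>
    mem_of_mem_closure_of_irreducible (D := {s | s ∣ d}) (hd.2.1 ▸ Submonoid.mem_top _)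
      (M.irreducible_artinGen i)

theorem isMinimalGarsideElement_iff {d : M.ArtinMonoid} :
    IsMinimalGarsideElement d ↔ d = cs.delta := by
  have hmin : ∀ d' : M.ArtinMonoid, IsGarsideElement d' → M.degree cs.delta ≤ M.degree d' := by
    intro d' hd'
    obtain ⟨c, rfl⟩ := cs.delta_dvd_of_isGarsideElement hd'
    rw [M.degree_mul]; omega
  constructor
  · rintro ⟨hd, hle⟩
    have h := hle _ cs.isGarsideElement_delta
    rw [M.atomNorm_eq_degree, M.atomNorm_eq_degree, Nat.cast_le] at h
    obtain ⟨c, rfl⟩ := cs.delta_dvd_of_isGarsideElement hd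
    rw [M.degree_mul] at h
    rw [M.eq_one_of_degree_eq_zero (g := c) (by omega), mul_one]
  · rintro rfl
    refine ⟨cs.isGarsideElement_delta, fun d' hd' => ?_⟩
    rw [M.atomNorm_eq_degree, M.atomNorm_eq_degree, Nat.cast_le]
    exact hmin d' hd'

theorem garsideDelta_eq : garsideDelta M.ArtinMonoid = cs.delta :=
  cs.isMinimalGarsideElement_iff.mp
    (Classical.epsilon_spec ⟨cs.delta, cs.isMinimalGarsideElement_iff.mpr rfl⟩)

theorem isSimpleElement_iff {g : M.ArtinMonoid} : IsSimpleElement g ↔ ∃ w, g = cs.toArtin w := by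
  rw [IsSimpleElement, cs.garsideDelta_eq, dvd_delta_iff]

/-! ### Purity of the generators -/

theorem absorbed_simple_self (i : S) : cs.absorbed (cs.simple i) (cs.simple i) = 1 := by
  by_contra hne
  have h1 := cs.absorbed_isPrefix (cs.simple i) (cs.simple i)
  have h2 := cs.lengthAdd_absorbed (cs.simple i) (cs.simple i)
  have h3 : cs.length (cs.absorbed (cs.simple i) (cs.simple i)) ≠ 0 :=
    fun h => hne (cs.length_eq_zero_iff.mp h)
  rw [h1.eq_of_length_le (by rw [cs.length_simple]; omega), lengthAdd_simple_iff, IsLeftDescent] at h2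
  simp at h2

theorem head_artinGen_pow_succ (i : S) (k : ℕ) :
    cs.head (M.artinGen i ^ (k + 1)) = cs.simple i := by
  induction k with
  | zero => rw [zero_add, pow_one, ← cs.toArtin_simple, head_toArtin]
  | succ k ih =>
    rw [pow_succ', ← cs.toArtin_simple, head_toArtin_mul, toArtin_simple, ih, absorbed_simple_self,
      mul_one]

theorem isPureSimple_artinGen (cs : CoxeterSystem M W) (i : S) : IsPureSimple (M.artinGen i) := by
  refine ⟨cs.isSimpleElement_iff.mpr ⟨_, (cs.toArtin_simple i).symm⟩, fun k hk => ?_⟩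
  obtain ⟨k, rfl⟩ := Nat.exists_eq_add_of_le' hk
  refine ⟨⟨_, pow_succ _ _⟩, fun t ht htk => ?_⟩
  obtain ⟨w, rfl⟩ := cs.isSimpleElement_iff.mp ht
  rw [M.isRightDivisor_iff_reverse_dvd, reverse_toArtin, toArtin_dvd_iff] at htk ⊢
  rw [M.reverse_pow, M.reverse_artinGen, head_artinGen_pow_succ] at htk
  rwa [M.reverse_artinGen, ← cs.toArtin_simple, head_toArtin]

/-! ### Divisibility of multiples of the Garside element -/

/-- Conjugation by the longest element permutes the simple reflections. With `t` the image of `sᵢ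
w₀`, one has `Δ = σᵢ t = t σⱼ`, so both sides equal `σᵢ t σⱼ`. -/
theorem exists_artinGen_mul_delta (i : S) :
    ∃ j, M.artinGen i * cs.delta = cs.delta * M.artinGen j := by
  obtain ⟨j, hj⟩ := cs.exists_longest_mul_simple_mul_longest i
  have e : cs.simple i * cs.longest * cs.simple j = cs.longest := by
    rw [← hj]
    have := cs.longest_mul_self
    simp only [mul_assoc]
    rw [← mul_assoc cs.longest, this, one_mul, simple_mul_simple_cancel_left]
  have hl := cs.length_mul_longest (cs.simple i)
  rw [cs.length_simple] at hl
  have h1 : cs.LengthAdd (cs.simple i) (cs.simple i * cs.longest) := by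
    rw [LengthAdd, simple_mul_simple_cancel_left, cs.length_simple]; omega
  have h2 : cs.LengthAdd (cs.simple i * cs.longest) (cs.simple j) := by
    rw [LengthAdd, e, cs.length_simple]; omega
  have e1 := cs.toArtin_mul h1
  have e2 := cs.toArtin_mul h2
  rw [simple_mul_simple_cancel_left, toArtin_simple] at e1
  rw [e, toArtin_simple] at e2
  refine ⟨j, ?_⟩
  rw [delta]
  nth_rewrite 1 [e2]
  rw [← mul_assoc, ← e1]

theorem exists_mul_delta (g : M.ArtinMonoid) : ∃ g', g * cs.delta = cs.delta * g' := by
  induction g using M.artinMonoid_induction with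
  | one => exact ⟨1, by rw [one_mul, mul_one]⟩
  | gen_mul i g ih =>
    obtain ⟨g', hg'⟩ := ih
    obtain ⟨j, hj⟩ := cs.exists_artinGen_mul_delta i
    exact ⟨M.artinGen j * g', by rw [mul_assoc, hg', ← mul_assoc, hj, mul_assoc]⟩

theorem exists_mul_delta_pow (g : M.ArtinMonoid) (n : ℕ) :
    ∃ g', g * cs.delta ^ n = cs.delta ^ n * g' := by
  induction n with
  | zero => exact ⟨g, by simp⟩
  | succ n ih =>
    obtain ⟨g', hg'⟩ := ih
    obtain ⟨g'', hg''⟩ := cs.exists_mul_delta g'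
    exact ⟨g'', by rw [pow_succ, ← mul_assoc, hg', mul_assoc, hg'', mul_assoc]⟩

theorem exists_delta_pow_mul (g : M.ArtinMonoid) (n : ℕ) :
    ∃ g', cs.delta ^ n * g = g' * cs.delta ^ n := by
  obtain ⟨h, hh⟩ := cs.exists_mul_delta_pow (M.reverse g) n
  have := congrArg M.reverse hh
  rw [M.reverse_mul, M.reverse_mul, M.reverse_pow, reverse_delta, M.reverse_reverse] at this
  exact ⟨_, this⟩

theorem exists_mul_eq_delta_pow (g : M.ArtinMonoid) : ∃ n h, g * h = cs.delta ^ n := by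
  induction g using M.artinMonoid_induction with
  | one => exact ⟨0, 1, by simp⟩
  | gen_mul i g ih =>
    obtain ⟨n, h, hh⟩ := ih
    obtain ⟨u, hu⟩ := cs.artinGen_dvd_delta i
    obtain ⟨u', hu'⟩ := cs.exists_mul_delta_pow u n
    refine ⟨n + 1, h * u', ?_⟩
    rw [mul_assoc, ← mul_assoc g, hh, ← hu', ← mul_assoc, ← hu, pow_succ']

theorem exists_common_left_multiple (cs : CoxeterSystem M W) (a b : M.ArtinMonoid) :
    ∃ c d, c * a = d * b := by
  obtain ⟨n, h, hh⟩ := cs.exists_mul_eq_delta_pow (M.reverse a)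
  obtain ⟨m, k, hk⟩ := cs.exists_mul_eq_delta_pow (M.reverse b)
  have hh' := congrArg M.reverse hh
  have hk' := congrArg M.reverse hk
  rw [M.reverse_mul, M.reverse_pow, reverse_delta, M.reverse_reverse] at hh' hk'
  refine ⟨cs.delta ^ m * M.reverse h, cs.delta ^ n * M.reverse k, ?_⟩
  rw [mul_assoc, mul_assoc, hh', hk', ← pow_add, ← pow_add, add_comm]

/-- Purity at work. If `z Δ = σ ^ (n + 1) a`, reversal shows that `Δ` left divides `a' σ ^ (n + 1)`,
where `a'` is the reverse of `a`. This depends only on the head of the power, so `Δ` already left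
divides `a' σ`. Reversing back, `σ a = b Δ` for some `b`, and cancelling `Δ` gives `z = σ ^ n b`. -/
theorem artinGen_pow_succ_dvd_mul_delta_iff (i : S) (n : ℕ) (z : M.ArtinMonoid) :
    M.artinGen i ^ (n + 1) ∣ z * cs.delta ↔ M.artinGen i ^ n ∣ z := by
  have := cs.artinMonoid_isCancelMul
  constructor
  · rintro ⟨a, ha⟩
    have h1 := congrArg M.reverse ha
    rw [M.reverse_mul, M.reverse_mul, reverse_delta, M.reverse_pow, M.reverse_artinGen] at h1
    have h2 : cs.delta ∣ M.reverse a * M.artinGen i ^ (n + 1) := ⟨_, h1.symm⟩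
    have h3 : cs.delta ∣ M.reverse a * M.artinGen i := by
      rw [delta, toArtin_dvd_iff] at h2 ⊢
      rwa [cs.head_mul_congr (M.reverse a) (h' := M.artinGen i)
        (by rw [head_artinGen_pow_succ, ← cs.toArtin_simple, head_toArtin])] at h2
    obtain ⟨b, hb⟩ := h3
    have h4 := congrArg M.reverse hb
    rw [M.reverse_mul, M.reverse_mul, M.reverse_reverse, reverse_delta, M.reverse_artinGen] at h4
    rw [pow_succ, mul_assoc, h4, ← mul_assoc] at ha
    exact ⟨_, mul_right_cancel ha⟩
  · rintro ⟨y, rfl⟩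
    obtain ⟨y', hy'⟩ := cs.exists_mul_delta y
    obtain ⟨u, hu⟩ := cs.artinGen_dvd_delta i
    refine ⟨u * y', ?_⟩
    rw [mul_assoc, hy', pow_succ, mul_assoc, ← mul_assoc _ u, ← hu]

theorem artinGen_pow_add_dvd_mul_delta_pow_iff (i : S) (n k : ℕ) (z : M.ArtinMonoid) :
    M.artinGen i ^ (n + k) ∣ z * cs.delta ^ k ↔ M.artinGen i ^ n ∣ z := by
  induction k with
  | zero => simp
  | succ k ih =>
    rw [pow_succ, ← mul_assoc, ← add_assoc, artinGen_pow_succ_dvd_mul_delta_iff, ih]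

theorem isGreatest_mul_delta_pow {i : S} {n : ℕ} {z : M.ArtinMonoid} (k : ℕ)
    (h : IsGreatest {m : ℕ | M.artinGen i ^ m ∣ z} n) :
    IsGreatest {m : ℕ | M.artinGen i ^ m ∣ z * cs.delta ^ k} (n + k) := by
  refine ⟨(cs.artinGen_pow_add_dvd_mul_delta_pow_iff i n k z).mpr h.1, fun m hm => ?_⟩
  rcases Nat.le_total m k with hmk | hmk
  · omega
  · obtain ⟨m, rfl⟩ := Nat.exists_eq_add_of_le' hmk
    have := h.2 ((cs.artinGen_pow_add_dvd_mul_delta_pow_iff i m k z).mp hm)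
    omega

/-! ### The Artin–Tits group and the valuations -/

/-- An embedding of `A⁺` into some group respects the braid relations, so it factors through `A`. -/
theorem artinMonoidToGroup_injective (cs : CoxeterSystem M W) :
    Function.Injective M.artinMonoidToGroup := by
  have := cs.artinMonoid_isCancelMul
  obtain ⟨O, _, f, hf⟩ := exists_injective_hom_units cs.exists_common_left_multiple
  have hrel : ∀ r ∈ M.artinRelators, FreeGroup.lift (fun i => f (M.artinGen i)) r = 1 := by
    rintro r ⟨i, j, hij, rfl⟩
    rw [map_mul, map_inv, map_altProd, map_altProd, FreeGroup.lift_apply_of,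
      FreeGroup.lift_apply_of, ← map_altProd, ← map_altProd, M.altProd_artinGen_comm hij,
      mul_inv_cancel]
  have hφ : ∀ g, PresentedGroup.toGroup hrel (M.artinMonoidToGroup g) = f g := by
    intro g
    induction g using M.artinMonoid_induction with
    | one => simp
    | gen_mul i g ih =>
      rw [map_mul, map_mul, ih, map_mul]
      congr 1
      exact PresentedGroup.toGroup.of hrel
  intro a b hab
  apply hf
  rw [← hφ, ← hφ, hab]

theorem exists_delta_zpow_mul (g : M.ArtinMonoid) (k : ℤ) :
    ∃ g', M.artinMonoidToGroup cs.delta ^ k * M.artinMonoidToGroup g =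
      M.artinMonoidToGroup g' * M.artinMonoidToGroup cs.delta ^ k := by
  obtain ⟨n, rfl | rfl⟩ := k.eq_nat_or_neg
  · obtain ⟨g', hg'⟩ := cs.exists_delta_pow_mul g n
    refine ⟨g', ?_⟩
    rw [zpow_natCast, ← map_pow, ← map_mul, ← map_mul, hg']
  · obtain ⟨g', hg'⟩ := cs.exists_mul_delta_pow g n
    refine ⟨g', ?_⟩
    rw [zpow_neg, zpow_natCast, ← map_pow, inv_mul_eq_iff_eq_mul, ← mul_assoc,
      eq_mul_inv_iff_mul_eq, ← map_mul, ← map_mul, hg']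

theorem exists_eq_mul_delta_zpow (x : M.ArtinGroup) : ∃ (z : M.ArtinMonoid) (k : ℤ),
    x = M.artinMonoidToGroup z * M.artinMonoidToGroup cs.delta ^ k := by
  have hx : x ∈ Subgroup.closure (Set.range (PresentedGroup.of : S → M.ArtinGroup)) := by
    rw [PresentedGroup.closure_range_of]; trivial
  induction hx using Subgroup.closure_induction_left with
  | one => exact ⟨1, 0, by simp⟩
  | mul_left x hx y _ ih =>
    obtain ⟨i, rfl⟩ := hx
    obtain ⟨z, k, rfl⟩ := ih
    exact ⟨M.artinGen i * z, k, by rw [map_mul, mul_assoc]; rfl⟩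
  | inv_mul_cancel x hx y _ ih =>
    obtain ⟨i, rfl⟩ := hx
    obtain ⟨z, k, rfl⟩ := ih
    obtain ⟨u, hu⟩ := cs.artinGen_dvd_delta i
    obtain ⟨g, hg⟩ := cs.exists_delta_zpow_mul z (-1)
    -- From `Δ = σ u`, an inverse generator is positive up to `Δ⁻¹`, which then moves past `z`.
    have hi : (PresentedGroup.of i : M.ArtinGroup)⁻¹ =
        M.artinMonoidToGroup u * (M.artinMonoidToGroup cs.delta)⁻¹ := by
      rw [hu, map_mul, mul_inv_rev, mul_inv_cancel_left]
      rfl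
    rw [zpow_neg_one] at hg
    refine ⟨u * g, -1 + k, ?_⟩
    rw [hi, mul_assoc, ← mul_assoc _ (M.artinMonoidToGroup z), hg, map_mul, zpow_add, zpow_neg_one]
    simp only [mul_assoc]

theorem isValuation_iff {i : S} {x : M.ArtinGroup} {v : ℤ} :
    IsValuation M.artinMonoidToGroup (M.artinGen i) x v ↔
      ∃ (z : M.ArtinMonoid) (k : ℤ) (n : ℕ),
        x = M.artinMonoidToGroup z * M.artinMonoidToGroup cs.delta ^ k ∧
        IsGreatest {m : ℕ | M.artinGen i ^ m ∣ z} n ∧ v = n + k := by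
  rw [IsValuation, cs.garsideDelta_eq]

/-- By injectivity the numerators of two decompositions differ by a power of `Δ`, which shifts the
exponent of the generator and the exponent of `Δ` by opposite amounts. -/
theorem isValuation_unique (cs : CoxeterSystem M W) {i : S} {x : M.ArtinGroup} {v v' : ℤ}
    (h : IsValuation M.artinMonoidToGroup (M.artinGen i) x v)
    (h' : IsValuation M.artinMonoidToGroup (M.artinGen i) x v') : v = v' := by
  rw [cs.isValuation_iff] at h h'
  obtain ⟨z, k, n, hx, hn, hv⟩ := h
  obtain ⟨z', k', n', hx', hn', hv'⟩ := h'
  wlog hle : k ≤ k' generalizing z k n z' k' n' v v'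
  · exact (this z' k' n' hx' hn' hv' z k n hx hn hv (by omega)).symm
  obtain ⟨j, rfl⟩ := Int.le.dest hle
  have hz : z = z' * cs.delta ^ j := by
    apply cs.artinMonoidToGroup_injective
    rw [map_mul, map_pow]
    rw [hx, add_comm, zpow_add, zpow_natCast, ← mul_assoc] at hx'
    exact mul_right_cancel hx'
  have h1 := cs.isGreatest_mul_delta_pow j hn'
  rw [← hz] at h1
  have := hn.unique h1
  subst this
  push_cast at hv
  omega

theorem exists_isValuation (cs : CoxeterSystem M W) (i : S) (x : M.ArtinGroup) :
    ∃ v, IsValuation M.artinMonoidToGroup (M.artinGen i) x v := by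
  obtain ⟨z, k, hx⟩ := cs.exists_eq_mul_delta_zpow x
  obtain ⟨n, hn⟩ := M.exists_isGreatest_artinGen_pow_dvd i z
  exact ⟨n + k, cs.isValuation_iff.mpr ⟨z, k, n, hx, hn, rfl⟩⟩

theorem isValuation_valuationSequence (cs : CoxeterSystem M W) (x : M.ArtinGroup) (i : S) :
    IsValuation M.artinMonoidToGroup (M.artinGen i) x (M.valuationSequence x i) :=
  Classical.epsilon_spec (cs.exists_isValuation i x)

/-- Moving `Δ ^ k` past `p` keeps `z` as a left factor of the new numerator, so its left divisors
survive. -/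
theorem valuationSequence_le_mul (cs : CoxeterSystem M W) (x : M.ArtinGroup) (p : M.ArtinMonoid)
    (i : S) : M.valuationSequence x i ≤ M.valuationSequence (x * M.artinMonoidToGroup p) i := by
  obtain ⟨z, k, n, hx, hn, hv⟩ := cs.isValuation_iff.mp (cs.isValuation_valuationSequence x i)
  obtain ⟨p', hp'⟩ := cs.exists_delta_zpow_mul p k
  obtain ⟨n', hn'⟩ := M.exists_isGreatest_artinGen_pow_dvd i (z * p')
  have h : IsValuation M.artinMonoidToGroup (M.artinGen i) (x * M.artinMonoidToGroup p)
      (n' + k) := by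
    refine cs.isValuation_iff.mpr ⟨z * p', k, n', ?_, hn', rfl⟩
    rw [hx, mul_assoc, hp', map_mul, mul_assoc]
  rw [hv, cs.isValuation_unique (cs.isValuation_valuationSequence _ i) h]
  have : n ≤ n' := hn'.2 (hn.1.mul_right p')
  omega

theorem valuationSequence_mul_delta (x : M.ArtinGroup) (i : S) :
    M.valuationSequence (x * M.artinMonoidToGroup cs.delta) i = M.valuationSequence x i + 1 := by
  obtain ⟨z, k, n, hx, hn, hv⟩ := cs.isValuation_iff.mp (cs.isValuation_valuationSequence x i)
  refine cs.isValuation_unique (cs.isValuation_valuationSequence _ i)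
    (cs.isValuation_iff.mpr ⟨z, k + 1, n, ?_, hn, by omega⟩)
  rw [hx, zpow_add_one, mul_assoc]

/-- Multiplying by a simple element increases each valuation by `0` or `1`. -/
theorem valuationSequence_mul_simple (cs : CoxeterSystem M W) (x : M.ArtinGroup)
    {s : M.ArtinMonoid} (hs : IsSimpleElement s) (i : S) :
    M.valuationSequence (x * M.artinMonoidToGroup s) i - M.valuationSequence x i = 0 ∨
      M.valuationSequence (x * M.artinMonoidToGroup s) i - M.valuationSequence x i = 1 := by
  rw [IsSimpleElement, cs.garsideDelta_eq] at hs
  obtain ⟨u, hu⟩ := hs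
  -- The valuation at `x s` is squeezed between those at `x` and at `x s u = x Δ`.
  have h1 := cs.valuationSequence_le_mul x s i
  have h2 := cs.valuationSequence_le_mul (x * M.artinMonoidToGroup s) u i
  rw [mul_assoc, ← map_mul, ← hu, valuationSequence_mul_delta] at h2
  omega

end CoxeterSystem

theorem propositionP {S : Type*} (M : CoxeterMatrix S) [Finite M.Group] :
    -- the element `Δ` and the valuations are well defined
    (∃! d : M.ArtinMonoid, IsMinimalGarsideElement d) ∧
    (∀ i : S, IsPureSimple (M.artinGen i)) ∧
    (∀ (i : S) (x : M.ArtinGroup),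
      ∃! v : ℤ, IsValuation M.artinMonoidToGroup (M.artinGen i) x v) ∧
    -- multiplying by a simple element or its inverse leads to a neighbouring type
    (∀ (x : M.ArtinGroup) (s : M.ArtinMonoid), IsSimpleElement s →
      AreNeighbours (M.typeOf x) (M.typeOf (x * M.artinMonoidToGroup s)) ∧
      AreNeighbours (M.typeOf x) (M.typeOf (x * (M.artinMonoidToGroup s)⁻¹))) := by
  set cs := M.toCoxeterSystem
  refine ⟨⟨cs.delta, cs.isMinimalGarsideElement_iff.mpr rfl,
    fun d hd => cs.isMinimalGarsideElement_iff.mp hd⟩, cs.isPureSimple_artinGen, fun i x => ?_,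
    fun x s hs => ⟨⟨_, _, rfl, rfl, Or.inl (cs.valuationSequence_mul_simple x hs)⟩,
      ⟨_, _, rfl, rfl, Or.inr fun i => ?_⟩⟩⟩
  · obtain ⟨v, hv⟩ := cs.exists_isValuation i x
    exact ⟨v, hv, fun v' hv' => cs.isValuation_unique hv' hv⟩
  · have h := cs.valuationSequence_mul_simple (x * (M.artinMonoidToGroup s)⁻¹) hs i
    rw [inv_mul_cancel_right] at h
    omega
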